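/- Let $k\ge 1$ be an integer and consider the free boson on a circle of radius $R=1/\sqrt{2k}$. Its (algebraic, complex) untwisted state space $\mathcal F$ has as basis the states $a_{-n_1}\cdots a_{-n_i}\,\bar a_{-n'_1}\cdots\bar a_{-n'_j}|m,n\rangle$ with $m,n\in\mathbb Z$ and positive integers $n_r,n'_r$, where $[a_r,a_s]=[\bar a_r,\bar a_s]=r\,\delta_{r+s,0}$, $[a_r,\bar a_s]=0$, $a_r|m,n\rangle=\bar a_r|m,n\rangle=0$ for $r>0$, $a_0|m,n\rangle=\frac{mk+n}{\sqrt{2k}}|m,n\rangle$ and $\bar a_0|m,n\rangle=\frac{mk-n}{\sqrt{2k}}|m,n\rangle$. For $\epsilon=\pm1$ the modes $J^{\epsilon}_j$ ($j\in\mathbb Z$) of $J^\epsilon(z)={:}e^{i\epsilon\sqrt{2k}\,\phi(z)}{:}$ are defined by $$\sum_{j\in\mathbb Z}J^{\epsilon}_j z^{-j-k}=\exp\Big(\epsilon\sqrt{2k}\sum_{r>0}\tfrac{a_{-r}}{r}z^{r}\Big)\exp\Big(-\epsilon\sqrt{2k}\sum_{r>0}\tfrac{a_{r}}{r}z^{-r}\Big)\,U^{\epsilon}\,z^{\epsilon\sqrt{2k}\,a_0},$$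 where $U^\epsilon$ commutes with all $a_r,\bar a_r$ with $r\neq0$ and $U^\epsilon|m,n\rangle=|m+\epsilon,n+\epsilon k\rangle$; the modes $\bar J^\epsilon_j$ are defined in the same way from the $\bar a_r$, with $\bar U^\epsilon|m,n\rangle=|m+\epsilon,n-\epsilon k\rangle$. Let $\mathbb Z_2$ act on $\mathcal F$ by $a_r\mapsto-a_r$, $\bar a_r\mapsto-\bar a_r$, $|m,n\rangle\mapsto|-m,-n\rangle$. Let $$S=\{a_na_m,\ J^+_j+J^-_j,\ a_n(J^+_j-J^-_j),\ \bar a_n\bar a_m,\ \bar J^+_j+\bar J^-_j,\ \bar a_n(\bar J^+_j-\bar J^-_j)\;:\;n,m,j\in\mathbb Z\}.$$ Write $|s,s'\rangle_*=|s+s',k(s-s')\rangle$ for $s,s'\in\mathbb Z$, and for a state $v$ let $E_{\alpha\beta}(v)$ ($\alpha,\beta\in\{0,1\}$) be the span of all $a_{-n_1}\cdots a_{-n_i}\bar a_{-n'_1}\cdots\bar a_{-n'_j}v$ with $n_r,n'_r>0$, $i\equiv\alpha$ and $j\equiv\beta\pmod 2$. The vacuum module $H_0\subset\mathcal F$ is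 the sum of the following subspaces: * for all $s,s'>0$ and $\alpha,\beta\in\{0,1\}$: $E_{\alpha\beta}\big(|s,s'\rangle_*+(-1)^{\alpha}|-s,s'\rangle_*+(-1)^{\beta}|s,-s'\rangle_*+(-1)^{\alpha+\beta}|-s,-s'\rangle_*\big)$; * for all $s>0$ and $\alpha\in\{0,1\}$: $E_{\alpha 0}\big(|s,0\rangle_*+(-1)^{\alpha}|-s,0\rangle_*\big)$; * for all $s'>0$ and $\beta\in\{0,1\}$: $E_{0\beta}\big(|0,s'\rangle_*+(-1)^{\beta}|0,-s'\rangle_*\big)$; * $E_{00}(|0,0\rangle)$. Then: 1. every element of $S$ commutes with the $\mathbb Z_2$ action; 2. the algebra generated by $S$, applied to the vacuum $|0,0\rangle$, gives exactly $H_0$; 3. with $L_0=\frac12a_0^2+\sum_{r>0}a_{-r}a_r$ and $\bar L_0=\frac12\bar a_0^2+\sum_{r>0}\bar a_{-r}\bar a_r$, the operator $L_0+\bar L_0$ preserves $H_0$ and is diagonalizable on it with real eigenvalues of finite multiplicity, and for every real $0<q<1$ $$\operatorname{Tr}_{H_0}q^{L_0+\bar L_0-1/12}=\chi^*_+(q)^2,\qquad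 \chi^*_+(q)=\sum_{n\ge1}\frac{q^{kn^2}}{\eta(q)}+\sum_{n\ge0}\frac{q^{(2n)^2}-q^{(2n+1)^2}}{\eta(q)},\qquad \eta(q)=q^{1/24}\prod_{n\ge1}(1-q^n).$$ -/

import Mathlib

open scoped Nat

noncomputable section

namespace OrbifoldBoson

/-- The two chiralities: `left` is the holomorphic (chiral) sector, with oscillators `a_n` and
currents `J^±`; `right` is the antiholomorphic (antichiral) sector, with `ā_n` and `J̄^±`. -/
inductive Chirality
  | left
  | right
  deriving DecidableEq

/-- `+1` for the left-moving and `-1` for the right-moving sector. -/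
def Chirality.sign : Chirality → ℤ
  | .left => 1
  | .right => -1

/-- Labels of the standard basis of the untwisted Fock space: `((m, n), μ)` is the label of
`∏_r a_{-r}^{μ (left, r)} ∏_r ā_{-r}^{μ (right, r)} |m, n⟩`, with `m` and `n` the momentum and
winding numbers. -/
abbrev Label := (ℤ × ℤ) × (Chirality × ℕ+ →₀ ℕ)

/-- The untwisted space of states of the circle theory, before the projection to `ℤ₂`-invariant
states: all finite linear combinations of the basis states. -/
abbrev Fock := Label →₀ ℂ

/-- The basis state with label `b`. -/
def basisState (b : Label) : Fock := Finsupp.single b 1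

/-- The lowest state `|m, n⟩`. -/
def ket (m n : ℤ) : Fock := basisState ((m, n), 0)

/-- The creation operator `a_{-r}` or `ā_{-r}`, `r > 0`. -/
def create (c : Chirality) (r : ℕ+) : Module.End ℂ Fock :=
  Finsupp.linearCombination ℂ fun b : Label =>
    basisState (b.1, b.2 + Finsupp.single (c, r) 1)

/-- The annihilation operator `a_r` or `ā_r`, `r > 0`, normalised by `[a_r, a_{-r}] = r`. -/
def annihilate (c : Chirality) (r : ℕ+) : Module.End ℂ Fock :=
  Finsupp.linearCombination ℂ fun b : Label =>
    (((r : ℕ) : ℂ) * (b.2 (c, r) : ℂ)) • basisState (b.1, b.2 - Finsupp.single (c, r) 1)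

/-- The integer `√(2k) p` where `p` is the left (right) momentum of `|m, n⟩`; it is `m k + n` on
the left and `m k - n` on the right. At radius `R = 1 / √(2k)` this is `p = m / (2R) ± n R`. -/
def charge (k : ℕ) (c : Chirality) (p : ℤ × ℤ) : ℤ := p.1 * k + c.sign * p.2

/-- The zero mode `a_0` or `ā_0`, with eigenvalue `(m k ± n) / √(2k)` on `|m, n⟩`. -/
def zeroMode (k : ℕ) (c : Chirality) : Module.End ℂ Fock :=
  Finsupp.linearCombination ℂ fun b : Label =>
    ((charge k c b.1 : ℂ) / (Real.sqrt (2 * k) : ℂ)) • basisState b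

/-- The oscillator mode `a_n` or `ā_n`, `n ∈ ℤ`. -/
def mode (k : ℕ) (c : Chirality) : ℤ → Module.End ℂ Fock
  | Int.ofNat 0 => zeroMode k c
  | Int.ofNat (n + 1) => annihilate c n.succPNat
  | Int.negSucc n => create c n.succPNat

/-- The coefficient of `z ^ N` in `exp (∑_{r ≥ 1} t_r z ^ r)`. The powers `T ^ i` with `i > N` do
not contribute, because `T` has no constant term. -/
def expCoeff {A : Type*} [Ring A] [Algebra ℂ A] (t : ℕ+ → A) (N : ℕ) : A :=
  ∑ i ∈ Finset.range (N + 1),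
    ((i ! : ℂ)⁻¹) • PowerSeries.coeff N
      ((PowerSeries.mk fun r : ℕ => if h : 0 < r then t ⟨r, h⟩ else 0) ^ i)

/-- The coefficient of `z ^ N` in `exp (ε √(2k) ∑_{r > 0} a_{-r} z ^ r / r)`. -/
def createExp (k : ℕ) (c : Chirality) (ε : ℤˣ) (N : ℕ) : Module.End ℂ Fock :=
  expCoeff (fun r : ℕ+ =>
    (((ε : ℤ) : ℂ) * (Real.sqrt (2 * k) : ℂ) / ((r : ℕ) : ℂ)) • create c r) N

/-- The coefficient of `z ^ (-M)` in `exp (- ε √(2k) ∑_{r > 0} a_r z ^ (-r) / r)`. -/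
def annihilateExp (k : ℕ) (c : Chirality) (ε : ℤˣ) (M : ℕ) : Module.End ℂ Fock :=
  expCoeff (fun r : ℕ+ =>
    (-(((ε : ℤ) : ℂ) * (Real.sqrt (2 * k) : ℂ) / ((r : ℕ) : ℂ))) • annihilate c r) M

/-- The translation of the left (right) momentum by `ε √(2k)`, the other one being fixed:
`|m, n⟩ ↦ |m + ε, n ± ε k⟩`, commuting with the oscillators. -/
def shift (k : ℕ) (c : Chirality) (ε : ℤˣ) : Module.End ℂ Fock :=
  Finsupp.linearCombination ℂ fun b : Label =>
    basisState ((b.1.1 + (ε : ℤ), b.1.2 + c.sign * (ε : ℤ) * k), b.2)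

/-- The oscillator energy `∑_r r μ (c, r)` of chirality `c`. -/
def level (c : Chirality) (μ : Chirality × ℕ+ →₀ ℕ) : ℕ :=
  μ.sum fun i e => if i.1 = c then (i.2 : ℕ) * e else 0

/-- The mode `J^ε_j` (or `J̄^ε_j`) of the normal ordered exponential
`J^ε(z) = :exp (i ε √(2k) φ(z)): = ∑_j J^ε_j z ^ (-j-k)`, that is, of
`exp (ε √(2k) ∑_{r>0} a_{-r} z^r / r) exp (- ε √(2k) ∑_{r>0} a_r z^{-r} / r) U z^{ε √(2k) a_0}`
where `U` is `shift`. On the basis state with label `b` the terms that contribute are those with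
`ε · charge + N - M = - j - k`, and the annihilation part vanishes for `M > level c b.2`. -/
def current (k : ℕ) (c : Chirality) (ε : ℤˣ) (j : ℤ) : Module.End ℂ Fock :=
  Finsupp.linearCombination ℂ fun b : Label =>
    ∑ M ∈ Finset.range (level c b.2 + 1),
      if 0 ≤ (M : ℤ) - j - k - (ε : ℤ) * charge k c b.1 then
        createExp k c ε ((M : ℤ) - j - k - (ε : ℤ) * charge k c b.1).toNat
          (annihilateExp k c ε M (shift k c ε (basisState b)))
      else 0

/-- The `ℤ₂` action `X ↦ -X`: it changes the sign of all oscillators and sends `|m, n⟩` to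
`|-m, -n⟩`. -/
def reflection : Module.End ℂ Fock :=
  Finsupp.linearCombination ℂ fun b : Label =>
    ((-1 : ℂ) ^ b.2.degree) • basisState ((-b.1.1, -b.1.2), b.2)

/-- The set `S` of modes: `a_n a_m`, `J^+_j + J^-_j`, `a_n (J^+_j - J^-_j)` for all integers
`n`, `m`, `j`, and their antichiral counterparts. -/
def modeSet (k : ℕ) : Set (Module.End ℂ Fock) :=
  {A | ∃ c : Chirality,
    (∃ n m : ℤ, A = mode k c n * mode k c m) ∨
    (∃ j : ℤ, A = current k c 1 j + current k c (-1) j) ∨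
    (∃ n j : ℤ, A = mode k c n * (current k c 1 j - current k c (-1) j))}

/-- The algebra of operators generated by `S`. -/
def symmetryAlgebra (k : ℕ) : Subalgebra ℂ (Module.End ℂ Fock) :=
  Algebra.adjoin ℂ (modeSet k)

/-- The subspace generated by the algebra from the state `v`: all `A v` with `A` in the algebra. -/
def generatedFrom (k : ℕ) (v : Fock) : Submodule ℂ Fock :=
  (Subalgebra.toSubmodule (symmetryAlgebra k)).map (LinearMap.applyₗ v)

/-- The span of the states `a_{-n_1} ⋯ a_{-n_i} ā_{-n'_1} ⋯ ā_{-n'_j} v` with `n_r, n'_r > 0`, where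
`i` satisfies `P` and `j` satisfies `P'`. -/
def excitations (P P' : ℕ → Prop) (v : Fock) : Submodule ℂ Fock :=
  Submodule.span ℂ {w | ∃ l l' : List ℕ+, P l.length ∧ P' l'.length ∧
    w = (l.map (create .left)).prod ((l'.map (create .right)).prod v)}

/-- The summand of the vacuum module over `|±s√(2k), ±s'√(2k)⟩`, for `s, s' > 0`. -/
def vacuumPart (k : ℕ) (s s' : ℤ) : Submodule ℂ Fock :=
  excitations Even Even
    (ket (s + s') (k * (s - s')) + ket (-(s + s')) (-(k * (s - s')))
      + ket (s - s') (k * (s + s')) + ket (-(s - s')) (-(k * (s + s')))) ⊔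
  excitations Odd Odd
    (ket (s + s') (k * (s - s')) + ket (-(s + s')) (-(k * (s - s')))
      - ket (s - s') (k * (s + s')) - ket (-(s - s')) (-(k * (s + s')))) ⊔
  excitations Odd Even
    (ket (s + s') (k * (s - s')) - ket (-(s + s')) (-(k * (s - s')))
      + ket (s - s') (k * (s + s')) - ket (-(s - s')) (-(k * (s + s')))) ⊔
  excitations Even Odd
    (ket (s + s') (k * (s - s')) - ket (-(s + s')) (-(k * (s - s')))
      - ket (s - s') (k * (s + s')) + ket (-(s - s')) (-(k * (s + s'))))

/-- The summand of the vacuum module over `|±s√(2k), 0⟩`, for `s > 0`. -/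
def vacuumPartLeft (k : ℕ) (s : ℤ) : Submodule ℂ Fock :=
  excitations Even Even (ket s (k * s) + ket (-s) (-(k * s))) ⊔
  excitations Odd Even (ket s (k * s) - ket (-s) (-(k * s)))

/-- The summand of the vacuum module over `|0, ±s'√(2k)⟩`, for `s' > 0`. -/
def vacuumPartRight (k : ℕ) (s' : ℤ) : Submodule ℂ Fock :=
  excitations Even Even (ket s' (-(k * s')) + ket (-s') (k * s')) ⊔
  excitations Even Odd (ket s' (-(k * s')) - ket (-s') (k * s'))

/-- The vacuum module `H_0`. -/
def vacuumModule (k : ℕ) : Submodule ℂ Fock :=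
  (⨆ (s : ℤ) (_ : 0 < s) (s' : ℤ) (_ : 0 < s'), vacuumPart k s s') ⊔
  (⨆ (s : ℤ) (_ : 0 < s), vacuumPartLeft k s) ⊔
  (⨆ (s' : ℤ) (_ : 0 < s'), vacuumPartRight k s') ⊔
  excitations Even Even (ket 0 0)

/-- The Virasoro zero mode `½ ∑_n :a_{-n} a_n: = ½ a_0² + ∑_{r > 0} a_{-r} a_r` of the given
chirality (`L_0` or `L̄_0`). On a basis state only the `r` with a nonzero occupation number
contribute. -/
def virasoroZero (k : ℕ) (c : Chirality) : Module.End ℂ Fock :=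
  Finsupp.linearCombination ℂ fun b : Label =>
    (1 / 2 : ℂ) • (zeroMode k c * zeroMode k c) (basisState b) +
      ∑ i ∈ b.2.support, if i.1 = c then (create c i.2 * annihilate c i.2) (basisState b) else 0

/-- `L_0 + L̄_0 - 1/12`. -/
def hamiltonian (k : ℕ) : Module.End ℂ Fock :=
  virasoroZero k .left + virasoroZero k .right - (1 / 12 : ℂ) • 1

/-- `t` is the trace of `q ^ T` over the subspace `W`: the operator `T` preserves `W`, `W` is
spanned by eigenvectors of `T` with real eigenvalues, each eigenvalue has finite multiplicity in
`W`, and `∑_x mult(x) q ^ x`, over the eigenvalues `x`, converges to `t`. -/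
def HasPowTrace {V : Type*} [AddCommGroup V] [Module ℂ V] (T : Module.End ℂ V)
    (W : Submodule ℂ V) (q t : ℝ) : Prop :=
  (∀ w ∈ W, T w ∈ W) ∧
  (⨆ x : ℝ, W ⊓ T.eigenspace (x : ℂ)) = W ∧
  (∀ x : ℝ, FiniteDimensional ℂ (W ⊓ T.eigenspace (x : ℂ) : Submodule ℂ V)) ∧
  HasSum (fun x : ℝ =>
    (Module.finrank ℂ (W ⊓ T.eigenspace (x : ℂ) : Submodule ℂ V) : ℝ) * q ^ x) t

/-- The Dedekind function `η(q) = q^{1/24} ∏_{n ≥ 1} (1 - q ^ n)`. -/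
def eta (q : ℝ) : ℝ := q ^ (1 / 24 : ℝ) * ∏' n : ℕ, (1 - q ^ (n + 1))

/-- The vacuum character
`χ*_+(q) = ∑_{n ≥ 1} q^{k n²} / η(q) + ∑_{n ≥ 0} (q^{(2n)²} - q^{(2n+1)²}) / η(q)`. -/
def vacuumCharacter (k : ℕ) (q : ℝ) : ℝ :=
  ∑' n : ℕ, q ^ (k * (n + 1) ^ 2) / eta q +
    ∑' n : ℕ, (q ^ ((2 * n) ^ 2) - q ^ ((2 * n + 1) ^ 2)) / eta q

end OrbifoldBoson

end

noncomputable section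

namespace OrbifoldBoson

open Filter Topology

/-! ### The exponential series -/

/-! Both the space generated from the vacuum and the vacuum module are identified with `symFock`.
This is the span of the states of charges `2ks` and `2ks'` symmetrized under two separate
reflections, one for each chirality, although only the diagonal reflection belongs to the orbifold
group.

Every generator in `S` involves one chirality and is even under the simultaneous change `a ↦ -a`,
`J^+ ↔ J^-`. It therefore commutes with every operator that induces this change, or no change, on
that chirality (`Intertwines.commute`). The reflection is of the first kind; the operators that
translate and excite the opposite chirality are of the second. Consequently the algebra commutes
with the `ℤ₂` action and preserves `symFock`.

Conversely, `symTranslate_zero_mem_chiralOrbit` climbs the charge lattice: on the symmetrized state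
of charge `s + 1`, a suitable mode of `J^+ + J^-` gives the one of charge `s + 2` plus descendants
of charge `s`, already obtained by induction. Products of two oscillators supply the descendants,
with `a_0` as the partner of a single creation operator when `s ≠ 0`. The two chiralities are then
combined by commutation (`symFock_le`).

Expanding the double symmetrization gives exactly the sign patterns of the vacuum module
(`symState_eq`, `vacuumModule_eq_symFock`). The symmetrized states with `s, s' ≥ 0`, restricted to
an even number of oscillators in a chirality of zero charge, are independent eigenvectors of the
Hamiltonian. Energies add, so the trace is the square of a chiral sum. Its part with `s > 0` is `∑
q^{ks²} / ∏ (1 - q^n)`. Its part with `s = 0` is the half-sum of `∏ (1 - q^n)⁻¹` and `∏ (1 +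
q^n)⁻¹`, which becomes the alternating theta series through Gauss's identity `∏ (1 - q^n)/(1 + q^n)
= ∑_{n ∈ ℤ} (-1)^n q^{n²}`. That identity is the limit of the finite form `sum_gaussTerm`. -/

lemma mul_coeff_pow_eq {A : Type*} [Ring A] (X : A) (f g : PowerSeries A)
    (h : ∀ n, X * PowerSeries.coeff n f = PowerSeries.coeff n g * X) (i N : ℕ) :
    X * PowerSeries.coeff N (f ^ i) = PowerSeries.coeff N (g ^ i) * X := by
  induction i generalizing N with
  | zero =>
    simp only [pow_zero, PowerSeries.coeff_one]
    split_ifs <;> simp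
  | succ i ih =>
    rw [pow_succ, pow_succ, PowerSeries.coeff_mul, PowerSeries.coeff_mul, Finset.mul_sum,
      Finset.sum_mul]
    refine Finset.sum_congr rfl fun p _ => ?_
    rw [← mul_assoc, ih, mul_assoc, h, mul_assoc]

/-- Moving `X` past each factor of a monomial in the `t r` turns it into the same monomial in the
`t' r`; no commutativity among the `t r` is needed. -/
lemma mul_expCoeff {A : Type*} [Ring A] [Algebra ℂ A] (X : A) (t t' : ℕ+ → A)
    (h : ∀ r, X * t r = t' r * X) (N : ℕ) : X * expCoeff t N = expCoeff t' N * X := by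
  rw [expCoeff, expCoeff, Finset.mul_sum, Finset.sum_mul]
  refine Finset.sum_congr rfl fun i _ => ?_
  rw [mul_smul_comm, smul_mul_assoc]
  congr 1
  refine mul_coeff_pow_eq X _ _ (fun n => ?_) i N
  rw [PowerSeries.coeff_mk, PowerSeries.coeff_mk]
  split_ifs
  · exact h _
  · simp

lemma coeff_pow_mem {A : Type*} [Ring A] [Algebra ℂ A] (B : Subalgebra ℂ A) (f : PowerSeries A)
    (h : ∀ n, PowerSeries.coeff n f ∈ B) (i N : ℕ) : PowerSeries.coeff N (f ^ i) ∈ B := by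
  induction i generalizing N with
  | zero =>
    rw [pow_zero, PowerSeries.coeff_one]
    split_ifs
    · exact B.one_mem
    · exact B.zero_mem
  | succ i ih =>
    rw [pow_succ, PowerSeries.coeff_mul]
    exact B.sum_mem fun p _ => B.mul_mem (ih _) (h _)

lemma expCoeff_mem {A : Type*} [Ring A] [Algebra ℂ A] (B : Subalgebra ℂ A) (t : ℕ+ → A)
    (h : ∀ r, t r ∈ B) (N : ℕ) : expCoeff t N ∈ B := by
  refine B.sum_mem fun i _ => B.smul_mem (coeff_pow_mem B _ (fun n => ?_) i N) _
  rw [PowerSeries.coeff_mk]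
  split_ifs
  · exact h _
  · exact B.zero_mem

lemma expCoeff_zero {A : Type*} [Ring A] [Algebra ℂ A] (t : ℕ+ → A) : expCoeff t 0 = 1 := by
  simp [expCoeff]

/-! ### Action on the basis -/

lemma fock_ext {A B : Module.End ℂ Fock} (h : ∀ b, A (basisState b) = B (basisState b)) :
    A = B := by
  refine Finsupp.lhom_ext' fun b => LinearMap.ext_ring ?_
  exact h b

lemma linearCombination_basisState (f : Label → Fock) (b : Label) :
    Finsupp.linearCombination ℂ f (basisState b) = f b := by
  simp [basisState]

@[simp] lemma create_basisState (c : Chirality) (r : ℕ+) (b : Label) :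
    create c r (basisState b) = basisState (b.1, b.2 + Finsupp.single (c, r) 1) :=
  linearCombination_basisState _ _

@[simp] lemma annihilate_basisState (c : Chirality) (r : ℕ+) (b : Label) :
    annihilate c r (basisState b) =
      (((r : ℕ) : ℂ) * (b.2 (c, r) : ℂ)) • basisState (b.1, b.2 - Finsupp.single (c, r) 1) :=
  linearCombination_basisState _ _

@[simp] lemma zeroMode_basisState (k : ℕ) (c : Chirality) (b : Label) :
    zeroMode k c (basisState b) =
      ((charge k c b.1 : ℂ) / (Real.sqrt (2 * k) : ℂ)) • basisState b :=
  linearCombination_basisState _ _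

@[simp] lemma shift_basisState (k : ℕ) (c : Chirality) (ε : ℤˣ) (b : Label) :
    shift k c ε (basisState b) =
      basisState ((b.1.1 + (ε : ℤ), b.1.2 + c.sign * (ε : ℤ) * k), b.2) :=
  linearCombination_basisState _ _

@[simp] lemma reflection_basisState (b : Label) :
    reflection (basisState b) =
      ((-1 : ℂ) ^ b.2.degree) • basisState ((-b.1.1, -b.1.2), b.2) :=
  linearCombination_basisState _ _

lemma current_basisState (k : ℕ) (c : Chirality) (ε : ℤˣ) (j : ℤ) (b : Label) :
    current k c ε j (basisState b) = ∑ M ∈ Finset.range (level c b.2 + 1),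
      if 0 ≤ (M : ℤ) - j - k - (ε : ℤ) * charge k c b.1 then
        createExp k c ε ((M : ℤ) - j - k - (ε : ℤ) * charge k c b.1).toNat
          (annihilateExp k c ε M (shift k c ε (basisState b)))
      else 0 :=
  linearCombination_basisState _ _

/-! ### Operators intertwining the modes of one chirality -/

/-- `Ψ` intertwines the oscillators and the momentum shifts of chirality `c` up to the sign `σ`. -/
structure Intertwines (k : ℕ) (c : Chirality) (σ : ℤˣ) (Ψ : Module.End ℂ Fock) : Prop where
  create : ∀ r, Ψ * create c r = (((σ : ℤ) : ℂ) • create c r) * Ψ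
  annihilate : ∀ r, Ψ * annihilate c r = (((σ : ℤ) : ℂ) • annihilate c r) * Ψ
  shift : ∀ ε, Ψ * shift k c ε = shift k c (σ * ε) * Ψ
  basis : ∀ b, ∃ (x : ℂ) (b' : Label), Ψ (basisState b) = x • basisState b' ∧
    level c b'.2 = level c b.2 ∧ charge k c b'.1 = σ * charge k c b.1

namespace Intertwines

variable {k : ℕ} {c : Chirality} {σ : ℤˣ} {Ψ : Module.End ℂ Fock}

lemma createExp (h : Intertwines k c σ Ψ) (ε : ℤˣ) (N : ℕ) :
    Ψ * createExp k c ε N = OrbifoldBoson.createExp k c (σ * ε) N * Ψ := by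
  refine mul_expCoeff _ _ _ (fun r => ?_) N
  rw [mul_smul_comm, h.create, ← smul_mul_assoc, smul_smul]
  congr 2
  push_cast
  ring

lemma annihilateExp (h : Intertwines k c σ Ψ) (ε : ℤˣ) (N : ℕ) :
    Ψ * annihilateExp k c ε N = OrbifoldBoson.annihilateExp k c (σ * ε) N * Ψ := by
  refine mul_expCoeff _ _ _ (fun r => ?_) N
  rw [mul_smul_comm, h.annihilate, ← smul_mul_assoc, smul_smul]
  congr 2
  push_cast
  ring

/-- The currents are defined on basis states, with a truncation by level and an exponent fixed by
the charge. The field `basis` ensures that `Ψ` respects both: `(σε)(σ·charge) = ε·charge` and the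
level is unchanged. -/
lemma current (h : Intertwines k c σ Ψ) (ε : ℤˣ) (j : ℤ) :
    Ψ * current k c ε j = OrbifoldBoson.current k c (σ * ε) j * Ψ := by
  refine fock_ext fun b => ?_
  obtain ⟨x, b', hb, hl, hc⟩ := h.basis b
  have hs : x • OrbifoldBoson.shift k c (σ * ε) (basisState b') =
      Ψ (OrbifoldBoson.shift k c ε (basisState b)) := by
    rw [← map_smul, ← hb]
    exact (LinearMap.congr_fun (h.shift ε) (basisState b)).symm
  rw [Module.End.mul_apply, Module.End.mul_apply, hb, map_smul, current_basisState,
    current_basisState, map_sum, Finset.smul_sum, hl, hc]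
  have hσ : ((σ * ε : ℤˣ) : ℤ) * (σ * charge k c b.1) = ε * charge k c b.1 := by
    have : (σ : ℤ) * σ = 1 := Int.units_coe_mul_self σ
    push_cast
    linear_combination (ε : ℤ) * charge k c b.1 * this
  refine Finset.sum_congr rfl fun M _ => ?_
  rw [hσ]
  split_ifs
  · rw [← map_smul, ← map_smul, hs]
    have h1 := LinearMap.congr_fun (h.createExp ε
      ((M : ℤ) - j - k - (ε : ℤ) * charge k c b.1).toNat)
      (OrbifoldBoson.annihilateExp k c ε M (OrbifoldBoson.shift k c ε (basisState b)))
    have h2 := LinearMap.congr_fun (h.annihilateExp ε M)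
      (OrbifoldBoson.shift k c ε (basisState b))
    simp only [Module.End.mul_apply] at h1 h2
    rw [h1, h2]
  · simp

lemma zeroMode (h : Intertwines k c σ Ψ) :
    Ψ * zeroMode k c = (((σ : ℤ) : ℂ) • zeroMode k c) * Ψ := by
  refine fock_ext fun b => ?_
  obtain ⟨x, b', hb, -, hc⟩ := h.basis b
  simp only [Module.End.mul_apply, LinearMap.smul_apply, zeroMode_basisState, map_smul, hb, hc,
    smul_smul]
  congr 1
  have : ((σ : ℤ) : ℂ) * ((σ : ℤ) : ℂ) = 1 := by exact_mod_cast Int.units_coe_mul_self σ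
  push_cast
  linear_combination -(x * (charge k c b.1 : ℂ) / (Real.sqrt (2 * k) : ℂ)) * this

lemma mode (h : Intertwines k c σ Ψ) (n : ℤ) :
    Ψ * mode k c n = (((σ : ℤ) : ℂ) • mode k c n) * Ψ := by
  match n with
  | Int.ofNat 0 => exact h.zeroMode
  | Int.ofNat (n + 1) => exact h.annihilate _
  | Int.negSucc n => exact h.create _

end Intertwines

/-- The modes in `modeSet` of one chirality. -/
def chiralModeSet (k : ℕ) (c : Chirality) : Set (Module.End ℂ Fock) :=
  {A | (∃ n m : ℤ, A = mode k c n * mode k c m) ∨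
    (∃ j : ℤ, A = current k c 1 j + current k c (-1) j) ∨
    (∃ n j : ℤ, A = mode k c n * (current k c 1 j - current k c (-1) j))}

lemma mem_modeSet {k : ℕ} {A : Module.End ℂ Fock} :
    A ∈ modeSet k ↔ ∃ c, A ∈ chiralModeSet k c := Iff.rfl

/-- Passing `Ψ` through `a_n` or through `J^+ - J^-` costs a factor `σ`, and through `J^+ + J^-`
none. Each generator contains an even number of factors of the first kind, and `σ² = 1`. -/
lemma Intertwines.commute {k : ℕ} {c : Chirality} {σ : ℤˣ} {Ψ : Module.End ℂ Fock}
    (h : Intertwines k c σ Ψ) {A : Module.End ℂ Fock} (hA : A ∈ chiralModeSet k c) :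
    Commute A Ψ := by
  have hσ : ((σ : ℤ) : ℂ) * ((σ : ℤ) : ℂ) = 1 := by exact_mod_cast Int.units_coe_mul_self σ
  have hm (n : ℤ) : Ψ * OrbifoldBoson.mode k c n =
      ((σ : ℤ) : ℂ) • (OrbifoldBoson.mode k c n * Ψ) := by
    rw [h.mode, smul_mul_assoc]
  have hd (j : ℤ) :
      Ψ * (OrbifoldBoson.current k c 1 j - OrbifoldBoson.current k c (-1) j) =
      ((σ : ℤ) : ℂ) •
        ((OrbifoldBoson.current k c 1 j - OrbifoldBoson.current k c (-1) j) * Ψ) := by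
    rw [(mul_sub Ψ _ _ :), h.current, h.current, ← (sub_mul _ _ Ψ :)]
    rcases Int.units_eq_one_or σ with rfl | rfl
    · simp
    · refine LinearMap.ext fun x => ?_
      simp [Module.End.mul_apply, LinearMap.sub_apply]
  refine Eq.symm ?_
  rcases hA with ⟨n, m, rfl⟩ | ⟨j, rfl⟩ | ⟨n, j, rfl⟩
  · rw [← mul_assoc, hm, smul_mul_assoc, mul_assoc, hm, mul_smul_comm, smul_smul, hσ, one_smul,
      mul_assoc]
  · rw [mul_add, h.current, h.current, ← add_mul]
    rcases Int.units_eq_one_or σ with rfl | rfl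
    · simp
    · simp [add_comm]
  · rw [← mul_assoc, hm, smul_mul_assoc, mul_assoc, hd, mul_smul_comm, smul_smul, hσ, one_smul,
      mul_assoc]

lemma charge_neg (k : ℕ) (c : Chirality) (p : ℤ × ℤ) :
    charge k c (-p.1, -p.2) = -charge k c p := by
  simp [charge]
  ring

lemma reflection_intertwines (k : ℕ) (c : Chirality) : Intertwines k c (-1) reflection where
  create r := by
    refine fock_ext fun b => ?_
    simp only [Module.End.mul_apply, create_basisState, reflection_basisState, map_smul,
      LinearMap.smul_apply, smul_smul, map_add, Finsupp.degree_single]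
    congr 1
    push_cast
    ring
  annihilate r := by
    refine fock_ext fun b => ?_
    simp only [Module.End.mul_apply, annihilate_basisState, reflection_basisState, map_smul,
      LinearMap.smul_apply, smul_smul]
    -- Subtraction of occupation numbers is truncated; at occupation zero the coefficient vanishes,
    -- so the label is irrelevant.
    rcases Nat.eq_zero_or_pos (b.2 (c, r)) with h0 | h0
    · simp [h0]
    · have : (b.2 - Finsupp.single (c, r) 1) + Finsupp.single (c, r) 1 = b.2 :=
        tsub_add_cancel_of_le (by
        rw [Finsupp.single_le_iff]; exact h0)
      have hd := congrArg Finsupp.degree this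
      rw [map_add, Finsupp.degree_single] at hd
      rw [← hd]
      congr 1
      push_cast
      ring
  shift ε := by
    refine fock_ext fun b => ?_
    simp only [Module.End.mul_apply, shift_basisState, reflection_basisState, map_smul]
    congr 2
    ext <;> simp <;> ring
  basis b := ⟨_, _, reflection_basisState b, rfl, by rw [charge_neg]; simp⟩

theorem commute_reflection {k : ℕ} {A : Module.End ℂ Fock} (hA : A ∈ modeSet k) :
    Commute A reflection := by
  obtain ⟨c, hc⟩ := mem_modeSet.1 hA
  exact (reflection_intertwines k c).commute hc

/-! ### The translation operators of one chirality -/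

/-- The occupation numbers of the oscillators of one chirality, as occupation numbers of all
oscillators. -/
def embed (c : Chirality) : (ℕ+ →₀ ℕ) →+ (Chirality × ℕ+ →₀ ℕ) :=
  Finsupp.mapDomain.addMonoidHom fun r => (c, r)

lemma embed_single (c : Chirality) (r : ℕ+) (n : ℕ) :
    embed c (Finsupp.single r n) = Finsupp.single (c, r) n :=
  Finsupp.mapDomain_single

lemma embed_apply_same (c : Chirality) (ν : ℕ+ →₀ ℕ) (r : ℕ+) : embed c ν (c, r) = ν r :=
  Finsupp.mapDomain_apply (Prod.mk_right_injective c) ν r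

lemma embed_apply_ne {c c' : Chirality} (h : c ≠ c') (ν : ℕ+ →₀ ℕ) (r : ℕ+) :
    embed c ν (c', r) = 0 := by
  refine Finsupp.mapDomain_of_notMem_range ν _ ?_
  rintro ⟨r', h'⟩
  exact h (congrArg Prod.fst h')

lemma finsupp_induction_single {ι : Type*} {p : (ι →₀ ℕ) → Prop} (h0 : p 0)
    (h1 : ∀ ν r, p ν → p (ν + Finsupp.single r 1)) (ν : ι →₀ ℕ) : p ν := by
  classical
  suffices h : ∀ m : Multiset ι, p (Multiset.toFinsupp m) by
    simpa using h (Finsupp.toMultiset ν)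
  intro m
  induction m using Multiset.induction_on with
  | empty => simpa using h0
  | cons r m ih =>
    rw [← Multiset.singleton_add, add_comm, map_add, Multiset.toFinsupp_singleton]
    exact h1 _ _ ih

lemma degree_embed (c : Chirality) (ν : ℕ+ →₀ ℕ) : (embed c ν).degree = ν.degree := by
  induction ν using finsupp_induction_single with
  | h0 => simp
  | h1 ν r ih => simp [ih, embed_single]

lemma level_add (c : Chirality) (μ ν : Chirality × ℕ+ →₀ ℕ) :
    level c (μ + ν) = level c μ + level c ν := by
  refine Finsupp.sum_add_index' (fun i => by simp) fun i m n => ?_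
  split_ifs
  · ring
  · rfl

lemma level_single (c : Chirality) (i : Chirality × ℕ+) (n : ℕ) :
    level c (Finsupp.single i n) = if i.1 = c then (i.2 : ℕ) * n else 0 :=
  Finsupp.sum_single_index (by simp)

@[simp] lemma level_zero (c : Chirality) : level c 0 = 0 := Finsupp.sum_zero_index

lemma level_embed_ne {c c' : Chirality} (h : c ≠ c') (ν : ℕ+ →₀ ℕ) :
    level c' (embed c ν) = 0 := by
  induction ν using finsupp_induction_single with
  | h0 => simp
  | h1 ν r ih => simp [level_add, ih, embed_single, level_single, h]

lemma embed_sub_single (c : Chirality) (ν : ℕ+ →₀ ℕ) (r : ℕ+) :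
    embed c ν - Finsupp.single (c, r) 1 = embed c (ν - Finsupp.single r 1) := by
  rw [← embed_single]
  ext ⟨c', r'⟩
  by_cases h : c = c'
  · subst h
    simp [embed_apply_same]
  · simp [embed_apply_ne h]

lemma sign_mul_sign_of_ne {c c' : Chirality} (h : c ≠ c') : c'.sign * c.sign = -1 := by
  cases c <;> cases c' <;> simp [Chirality.sign] at h ⊢

lemma sign_mul_self (c : Chirality) : c.sign * c.sign = 1 := by
  cases c <;> simp [Chirality.sign]

/-- The translation of the momentum of chirality `c` by `x.1` units `√(2k)`, together with the
creation of the oscillators `x.2`. -/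
def translate (k : ℕ) (c : Chirality) (x : ℤ × (ℕ+ →₀ ℕ)) : Module.End ℂ Fock :=
  Finsupp.linearCombination ℂ fun b : Label =>
    basisState ((b.1.1 + x.1, b.1.2 + c.sign * x.1 * k), b.2 + embed c x.2)

@[simp] lemma translate_basisState (k : ℕ) (c : Chirality) (x : ℤ × (ℕ+ →₀ ℕ)) (b : Label) :
    translate k c x (basisState b) =
      basisState ((b.1.1 + x.1, b.1.2 + c.sign * x.1 * k), b.2 + embed c x.2) :=
  linearCombination_basisState _ _

/-- The vector `(x, ±xk)` changes the charge of chirality `c` only, since it is annihilated by the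
charge of the other chirality; likewise the created oscillators have level zero there. -/
lemma translate_intertwines (k : ℕ) {c c' : Chirality} (h : c ≠ c') (x : ℤ × (ℕ+ →₀ ℕ)) :
    Intertwines k c' 1 (translate k c x) where
  create r := by
    refine fock_ext fun b => ?_
    simp [Module.End.mul_apply, add_right_comm]
  annihilate r := by
    refine fock_ext fun b => ?_
    simp only [Module.End.mul_apply, annihilate_basisState, translate_basisState, map_smul,
      Finsupp.add_apply, embed_apply_ne h, Units.val_one, Int.cast_one,
      one_smul, add_zero]
    rcases Nat.eq_zero_or_pos (b.2 (c', r)) with h0 | h0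
    · simp [h0]
    · rw [tsub_add_eq_add_tsub]
      rw [Finsupp.single_le_iff]
      exact h0
  shift ε := by
    refine fock_ext fun b => ?_
    simp only [Module.End.mul_apply, shift_basisState, translate_basisState, one_mul]
    congr 2
    ext <;> simp <;> ring
  basis b := by
    refine ⟨1, _, by rw [translate_basisState, one_smul], ?_, ?_⟩
    · rw [level_add, level_embed_ne h, add_zero]
    · simp only [charge, Units.val_one, one_mul]
      linear_combination x.1 * k * sign_mul_sign_of_ne h

lemma translate_commute (k : ℕ) (c c' : Chirality) (x y : ℤ × (ℕ+ →₀ ℕ)) :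
    Commute (translate k c x) (translate k c' y) := by
  refine fock_ext fun b => ?_
  simp only [Module.End.mul_apply, translate_basisState]
  congr 2
  · ext <;> simp <;> ring
  · exact add_right_comm _ _ _

/-- The twisted symmetrization of `translate` under the reflection. -/
def symTranslate (k : ℕ) (c : Chirality) (x : ℤ × (ℕ+ →₀ ℕ)) : Module.End ℂ Fock :=
  translate k c x + ((-1 : ℂ) ^ x.2.degree) • translate k c (-x.1, x.2)

lemma symTranslate_commute (k : ℕ) (c c' : Chirality) (x y : ℤ × (ℕ+ →₀ ℕ)) :
    Commute (symTranslate k c x) (symTranslate k c' y) := by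
  have h := translate_commute k c c'
  refine Commute.add_left (.add_right (h _ _) ((h _ _).smul_right _))
    (.smul_left (.add_right (h _ _) ((h _ _).smul_right _)) _)

lemma commute_symTranslate {k : ℕ} {c c' : Chirality} (h : c ≠ c') (x : ℤ × (ℕ+ →₀ ℕ))
    {A : Module.End ℂ Fock} (hA : A ∈ chiralModeSet k c') : Commute A (symTranslate k c x) := by
  have h' (y) := (translate_intertwines k h y).commute hA
  exact .add_right (h' _) ((h' _).smul_right _)

/-- The state of momentum `x.1 √(2k)` and oscillators `x.2` of chirality `c` over the vacuum of the
other chirality. -/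
def sectorState (k : ℕ) (c : Chirality) (x : ℤ × (ℕ+ →₀ ℕ)) : Fock :=
  basisState ((x.1, c.sign * x.1 * k), embed c x.2)

lemma translate_vacuum (k : ℕ) (c : Chirality) (x : ℤ × (ℕ+ →₀ ℕ)) :
    translate k c x (ket 0 0) = sectorState k c x := by
  simp [ket, sectorState]

lemma symTranslate_vacuum (k : ℕ) (c : Chirality) (x : ℤ × (ℕ+ →₀ ℕ)) :
    symTranslate k c x (ket 0 0) =
      sectorState k c x + ((-1 : ℂ) ^ x.2.degree) • sectorState k c (-x.1, x.2) := by
  simp [symTranslate, translate_vacuum]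

lemma reflection_sectorState (k : ℕ) (c : Chirality) (x : ℤ × (ℕ+ →₀ ℕ)) :
    reflection (sectorState k c x) =
      ((-1 : ℂ) ^ x.2.degree) • sectorState k c (-x.1, x.2) := by
  simp [sectorState, degree_embed]

lemma reflection_reflection (v : Fock) : reflection (reflection v) = v := by
  suffices h : reflection * reflection = 1 from LinearMap.congr_fun h v
  refine fock_ext fun b => ?_
  simp [Module.End.mul_apply, smul_smul, ← mul_pow]

/-- Over the vacuum of the other chirality the full reflection acts as the reflection of one
chirality, which is why the sign in `symTranslate` is the right one. -/
lemma symTranslate_vacuum_eq_add_reflection (k : ℕ) (c : Chirality) (x : ℤ × (ℕ+ →₀ ℕ)) :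
    symTranslate k c x (ket 0 0) =
      sectorState k c x + reflection (sectorState k c x) := by
  rw [symTranslate_vacuum, reflection_sectorState]

/-! ### Invariant subspaces -/

/-- The algebra of the operators that preserve `N`. -/
def stabilizer (N : Submodule ℂ Fock) : Subalgebra ℂ (Module.End ℂ Fock) where
  carrier := {A | ∀ v ∈ N, A v ∈ N}
  mul_mem' hA hB v hv := hA _ (hB v hv)
  add_mem' hA hB v hv := N.add_mem (hA v hv) (hB v hv)
  algebraMap_mem' x v hv := by
    simpa [Module.algebraMap_end_apply] using N.smul_mem x hv

lemma mem_stabilizer {N : Submodule ℂ Fock} {A : Module.End ℂ Fock} :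
    A ∈ stabilizer N ↔ ∀ v ∈ N, A v ∈ N := Iff.rfl

lemma mem_stabilizer_span {s : Set Fock} {A : Module.End ℂ Fock}
    (h : ∀ v ∈ s, A v ∈ Submodule.span ℂ s) : A ∈ stabilizer (Submodule.span ℂ s) :=
  fun _ hv => (Submodule.span_le (p := (Submodule.span ℂ s).comap A)).2 h hv

/-- The states of chirality `c`, over the vacuum of the other chirality. -/
def sector (k : ℕ) (c : Chirality) : Submodule ℂ Fock :=
  Submodule.span ℂ (Set.range (sectorState k c))

/-- The reflection invariant states of chirality `c`, over the vacuum of the other chirality. -/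
def symSector (k : ℕ) (c : Chirality) : Submodule ℂ Fock :=
  Submodule.span ℂ (Set.range fun x => symTranslate k c x (ket 0 0))

lemma create_sectorState (k : ℕ) (c : Chirality) (r : ℕ+) (x : ℤ × (ℕ+ →₀ ℕ)) :
    create c r (sectorState k c x) = sectorState k c (x.1, x.2 + Finsupp.single r 1) := by
  simp [sectorState, embed_single]

lemma annihilate_sectorState (k : ℕ) (c : Chirality) (r : ℕ+) (x : ℤ × (ℕ+ →₀ ℕ)) :
    annihilate c r (sectorState k c x) =
      (((r : ℕ) : ℂ) * (x.2 r : ℂ)) • sectorState k c (x.1, x.2 - Finsupp.single r 1) := by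
  simp [sectorState, embed_sub_single, embed_apply_same]

lemma charge_sector (k : ℕ) (c : Chirality) (s : ℤ) :
    charge k c (s, c.sign * s * k) = 2 * k * s := by
  simp only [charge]
  linear_combination s * k * sign_mul_self c

lemma zeroMode_sectorState (k : ℕ) (c : Chirality) (x : ℤ × (ℕ+ →₀ ℕ)) :
    zeroMode k c (sectorState k c x) =
      (((2 * k * x.1 : ℤ) : ℂ) / (Real.sqrt (2 * k) : ℂ)) • sectorState k c x := by
  rw [sectorState, zeroMode_basisState, charge_sector]

lemma shift_sectorState (k : ℕ) (c : Chirality) (ε : ℤˣ) (x : ℤ × (ℕ+ →₀ ℕ)) :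
    shift k c ε (sectorState k c x) = sectorState k c (x.1 + ε, x.2) := by
  rw [sectorState, shift_basisState, sectorState]
  congr 2
  ext <;> simp
  ring

lemma sectorState_mem (k : ℕ) (c : Chirality) (x : ℤ × (ℕ+ →₀ ℕ)) :
    sectorState k c x ∈ sector k c := Submodule.subset_span ⟨x, rfl⟩

lemma create_mem_stabilizer (k : ℕ) (c : Chirality) (r : ℕ+) :
    create c r ∈ stabilizer (sector k c) := by
  refine mem_stabilizer_span ?_
  rintro _ ⟨x, rfl⟩
  rw [create_sectorState]
  exact sectorState_mem k c _

lemma annihilate_mem_stabilizer (k : ℕ) (c : Chirality) (r : ℕ+) :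
    annihilate c r ∈ stabilizer (sector k c) := by
  refine mem_stabilizer_span ?_
  rintro _ ⟨x, rfl⟩
  rw [annihilate_sectorState]
  exact Submodule.smul_mem _ _ (sectorState_mem k c _)

lemma mode_mem_stabilizer (k : ℕ) (c : Chirality) (n : ℤ) :
    mode k c n ∈ stabilizer (sector k c) := by
  match n with
  | Int.ofNat 0 =>
    refine mem_stabilizer_span ?_
    rintro _ ⟨x, rfl⟩
    rw [mode, zeroMode_sectorState]
    exact Submodule.smul_mem _ _ (sectorState_mem k c _)
  | Int.ofNat (n + 1) => exact annihilate_mem_stabilizer k c _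
  | Int.negSucc n => exact create_mem_stabilizer k c _

lemma current_mem_stabilizer (k : ℕ) (c : Chirality) (ε : ℤˣ) (j : ℤ) :
    current k c ε j ∈ stabilizer (sector k c) := by
  refine mem_stabilizer_span ?_
  rintro _ ⟨x, rfl⟩
  rw [sectorState, current_basisState]
  refine Submodule.sum_mem _ fun M _ => ?_
  split_ifs
  · refine (expCoeff_mem (stabilizer (sector k c)) _ (fun r => ?_) _ : createExp k c ε _ ∈ _) _ ?_
    · exact Subalgebra.smul_mem _ (create_mem_stabilizer k c r) _
    refine (expCoeff_mem (stabilizer (sector k c)) _ (fun r => ?_) _ :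
      annihilateExp k c ε _ ∈ _) _ ?_
    · exact Subalgebra.smul_mem _ (annihilate_mem_stabilizer k c r) _
    · rw [← sectorState, shift_sectorState]
      exact sectorState_mem k c _
  · exact Submodule.zero_mem _

lemma chiralModeSet_subset_stabilizer (k : ℕ) (c : Chirality) :
    chiralModeSet k c ⊆ stabilizer (sector k c) := by
  have hm := mode_mem_stabilizer k c
  have hc := current_mem_stabilizer k c
  rintro _ (⟨n, m, rfl⟩ | ⟨j, rfl⟩ | ⟨n, j, rfl⟩)
  · exact mul_mem (hm n) (hm m)
  · exact add_mem (hc _ j) (hc _ j)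
  · refine mul_mem (hm n) (mem_stabilizer.2 fun v hv => ?_)
    rw [LinearMap.sub_apply]
    exact Submodule.sub_mem _ (hc _ j v hv) (hc _ j v hv)

lemma symTranslate_vacuum_mem (k : ℕ) (c : Chirality) (x : ℤ × (ℕ+ →₀ ℕ)) :
    symTranslate k c x (ket 0 0) ∈ symSector k c := Submodule.subset_span ⟨x, rfl⟩

lemma add_reflection_mem {k : ℕ} {c : Chirality} {w : Fock} (hw : w ∈ sector k c) :
    w + reflection w ∈ symSector k c := by
  suffices h : sector k c ≤ (symSector k c).comap (LinearMap.id + reflection) from h hw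
  refine Submodule.span_le.2 ?_
  rintro _ ⟨x, rfl⟩
  rw [SetLike.mem_coe, Submodule.mem_comap, LinearMap.add_apply, LinearMap.id_apply,
    ← symTranslate_vacuum_eq_add_reflection]
  exact symTranslate_vacuum_mem k c x

/-- An invariant `w` equals `½ (w + reflection w)`. In this form invariance under the modes is
immediate from their commuting with the reflection. -/
lemma mem_symSector {k : ℕ} {c : Chirality} {w : Fock} :
    w ∈ symSector k c ↔ w ∈ sector k c ∧ reflection w = w := by
  constructor
  · intro hw
    induction hw using Submodule.span_induction with
    | mem w hw =>
      obtain ⟨x, rfl⟩ := hw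
      constructor
      · simp only [symTranslate_vacuum]
        exact add_mem (sectorState_mem k c _) (Submodule.smul_mem _ _ (sectorState_mem k c _))
      · simp only [symTranslate_vacuum_eq_add_reflection]
        rw [map_add, reflection_reflection, add_comm]
    | zero => exact ⟨Submodule.zero_mem _, map_zero _⟩
    | add v w _ _ hv hw => exact ⟨add_mem hv.1 hw.1, by rw [map_add, hv.2, hw.2]⟩
    | smul a v _ hv => exact ⟨Submodule.smul_mem _ a hv.1, by rw [map_smul, hv.2]⟩
  · rintro ⟨hw, hr⟩
    have h := Submodule.smul_mem _ (1 / 2 : ℂ) (add_reflection_mem hw)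
    rw [hr, ← two_smul ℂ w, smul_smul] at h
    simpa using h

lemma apply_mem_symSector {k : ℕ} {c : Chirality} {A : Module.End ℂ Fock}
    (hA : A ∈ chiralModeSet k c) {w : Fock} (hw : w ∈ symSector k c) : A w ∈ symSector k c := by
  rw [mem_symSector] at hw ⊢
  refine ⟨chiralModeSet_subset_stabilizer k c hA w hw.1, ?_⟩
  have h := LinearMap.congr_fun (commute_reflection (mem_modeSet.2 ⟨c, hA⟩)).eq w
  rw [Module.End.mul_apply, Module.End.mul_apply, hw.2] at h
  exact h.symm

/-- The tensor product of the two reflection invariant chiral sectors. -/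
def symFock (k : ℕ) : Submodule ℂ Fock :=
  Submodule.span ℂ (Set.range fun x : (ℤ × (ℕ+ →₀ ℕ)) × (ℤ × (ℕ+ →₀ ℕ)) =>
    symTranslate k .left x.1 (symTranslate k .right x.2 (ket 0 0)))

lemma symTranslate_mem_symFock (k : ℕ) (x y : ℤ × (ℕ+ →₀ ℕ)) :
    symTranslate k .left x (symTranslate k .right y (ket 0 0)) ∈ symFock k :=
  Submodule.subset_span ⟨(x, y), rfl⟩

lemma symTranslate_left_mem {k : ℕ} (x : ℤ × (ℕ+ →₀ ℕ)) {w : Fock}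
    (hw : w ∈ symSector k .right) : symTranslate k .left x w ∈ symFock k := by
  suffices h : symSector k .right ≤ (symFock k).comap (symTranslate k .left x) from h hw
  refine Submodule.span_le.2 ?_
  rintro _ ⟨y, rfl⟩
  rw [SetLike.mem_coe, Submodule.mem_comap]
  exact symTranslate_mem_symFock k x y

lemma symTranslate_comm_apply (k : ℕ) (c c' : Chirality) (x y : ℤ × (ℕ+ →₀ ℕ)) (v : Fock) :
    symTranslate k c x (symTranslate k c' y v) = symTranslate k c' y (symTranslate k c x v) :=
  LinearMap.congr_fun (symTranslate_commute k c c' x y).eq v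

lemma symTranslate_right_mem {k : ℕ} (y : ℤ × (ℕ+ →₀ ℕ)) {w : Fock}
    (hw : w ∈ symSector k .left) : symTranslate k .right y w ∈ symFock k := by
  suffices h : symSector k .left ≤ (symFock k).comap (symTranslate k .right y) from h hw
  refine Submodule.span_le.2 ?_
  rintro _ ⟨x, rfl⟩
  rw [SetLike.mem_coe, Submodule.mem_comap, symTranslate_comm_apply]
  exact symTranslate_mem_symFock k x y

/-- A mode commutes past the symmetrized translation of the opposite chirality and then acts on a
symmetric state of its own chirality over the vacuum. -/
lemma modeSet_subset_stabilizer (k : ℕ) : modeSet k ⊆ stabilizer (symFock k) := by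
  rintro A ⟨c, hA⟩
  refine mem_stabilizer_span ?_
  rintro _ ⟨⟨x, y⟩, rfl⟩
  change A (symTranslate k .left x (symTranslate k .right y (ket 0 0))) ∈ symFock k
  cases c with
  | left =>
    have h := commute_symTranslate (c := .right) (by decide) y hA
    rw [symTranslate_comm_apply, ← Module.End.mul_apply, h.eq, Module.End.mul_apply]
    exact symTranslate_right_mem y (apply_mem_symSector hA (symTranslate_vacuum_mem k _ x))
  | right =>
    have h := commute_symTranslate (c := .left) (by decide) x hA
    rw [← Module.End.mul_apply, h.eq, Module.End.mul_apply]
    exact symTranslate_left_mem x (apply_mem_symSector hA (symTranslate_vacuum_mem k _ y))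

lemma symTranslate_zero (k : ℕ) (c : Chirality) :
    symTranslate k c 0 = (2 : ℂ) • 1 := by
  refine fock_ext fun b => ?_
  simp [symTranslate, two_smul]

lemma vacuum_mem_symFock (k : ℕ) : ket 0 0 ∈ symFock k := by
  have h : symTranslate k .left 0 (symTranslate k .right 0 (ket 0 0)) ∈ symFock k :=
    symTranslate_mem_symFock k 0 0
  simp only [symTranslate_zero, LinearMap.smul_apply, Module.End.one_apply] at h
  rw [Submodule.smul_mem_iff _ two_ne_zero, Submodule.smul_mem_iff _ two_ne_zero] at h
  exact h

theorem generatedFrom_le (k : ℕ) : generatedFrom k (ket 0 0) ≤ symFock k := by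
  rintro _ ⟨A, hA, rfl⟩
  exact Algebra.adjoin_le (modeSet_subset_stabilizer k) hA _ (vacuum_mem_symFock k)

/-! ### The states generated from the vacuum by the modes of one chirality -/

/-- The states generated from the vacuum by the modes of one chirality. -/
def chiralOrbit (k : ℕ) (c : Chirality) : Submodule ℂ Fock :=
  (Subalgebra.toSubmodule (Algebra.adjoin ℂ (chiralModeSet k c))).map
    (LinearMap.applyₗ (ket 0 0))

lemma mem_chiralOrbit {k : ℕ} {c : Chirality} {w : Fock} :
    w ∈ chiralOrbit k c ↔ ∃ A ∈ Algebra.adjoin ℂ (chiralModeSet k c), A (ket 0 0) = w :=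
  Iff.rfl

lemma vacuum_mem_chiralOrbit (k : ℕ) (c : Chirality) : ket 0 0 ∈ chiralOrbit k c :=
  mem_chiralOrbit.2 ⟨1, one_mem _, rfl⟩

lemma apply_mem_chiralOrbit {k : ℕ} {c : Chirality} {A : Module.End ℂ Fock}
    (hA : A ∈ chiralModeSet k c) {w : Fock} (hw : w ∈ chiralOrbit k c) :
    A w ∈ chiralOrbit k c := by
  obtain ⟨B, hB, rfl⟩ := mem_chiralOrbit.1 hw
  exact mem_chiralOrbit.2 ⟨A * B, mul_mem (Algebra.subset_adjoin hA) hB, rfl⟩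

lemma mode_mode_mem {k : ℕ} {c : Chirality} {w : Fock} (hw : w ∈ chiralOrbit k c) (n m : ℤ) :
    mode k c n (mode k c m w) ∈ chiralOrbit k c :=
  apply_mem_chiralOrbit (A := mode k c n * mode k c m) (.inl ⟨n, m, rfl⟩) hw

lemma current_add_current_mem {k : ℕ} {c : Chirality} {w : Fock} (hw : w ∈ chiralOrbit k c)
    (j : ℤ) : current k c 1 j w + current k c (-1) j w ∈ chiralOrbit k c :=
  apply_mem_chiralOrbit (A := current k c 1 j + current k c (-1) j) (.inr (.inl ⟨j, rfl⟩)) hw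

lemma mode_zero (k : ℕ) (c : Chirality) : mode k c 0 = zeroMode k c := rfl

lemma exists_mode_eq_create (k : ℕ) (c : Chirality) (r : ℕ+) : ∃ n, mode k c n = create c r := by
  refine ⟨Int.negSucc r.natPred, ?_⟩
  rw [mode, PNat.succPNat_natPred]

lemma create_symTranslate_vacuum (k : ℕ) (c : Chirality) (r : ℕ+) (s : ℤ) (ν : ℕ+ →₀ ℕ) :
    create c r (symTranslate k c (s, ν) (ket 0 0)) =
      sectorState k c (s, ν + Finsupp.single r 1) -
        ((-1 : ℂ) ^ (ν + Finsupp.single r 1).degree) •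
          sectorState k c (-s, ν + Finsupp.single r 1) := by
  rw [symTranslate_vacuum, map_add, map_smul, create_sectorState, create_sectorState, map_add,
    Finsupp.degree_single, pow_succ, mul_neg_one, neg_smul, sub_neg_eq_add]

lemma create_create_symTranslate_vacuum (k : ℕ) (c : Chirality) (r r' : ℕ+) (s : ℤ)
    (ν : ℕ+ →₀ ℕ) :
    create c r' (create c r (symTranslate k c (s, ν) (ket 0 0))) =
      symTranslate k c (s, ν + Finsupp.single r 1 + Finsupp.single r' 1) (ket 0 0) := by
  rw [create_symTranslate_vacuum, symTranslate_vacuum, map_sub, map_smul, create_sectorState,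
    create_sectorState, map_add _ (ν + _), Finsupp.degree_single, pow_succ, mul_neg_one, neg_smul,
    sub_eq_add_neg]

lemma create_zeroMode_symTranslate_vacuum (k : ℕ) (c : Chirality) (r : ℕ+) (s : ℤ) :
    create c r (zeroMode k c (symTranslate k c (s, 0) (ket 0 0))) =
      (((2 * k * s : ℤ) : ℂ) / (Real.sqrt (2 * k) : ℂ)) •
        symTranslate k c (s, Finsupp.single r 1) (ket 0 0) := by
  simp only [symTranslate_vacuum, map_add, map_smul, zeroMode_sectorState, create_sectorState,
    zero_add, smul_add, Finsupp.degree_single, smul_smul]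
  congr 2
  simp
  ring

/-- Creation operators are available only in pairs, or singly together with the zero mode. -/
lemma symTranslate_mem_chiralOrbit {k : ℕ} (hk : 0 < k) {c : Chirality} {s : ℤ}
    (h : symTranslate k c (s, 0) (ket 0 0) ∈ chiralOrbit k c) (ν : ℕ+ →₀ ℕ) :
    symTranslate k c (s, ν) (ket 0 0) ∈ chiralOrbit k c := by
  -- Since pairs raise the oscillator number by two, the induction carries the states for `ν` and
  -- for all one-oscillator extensions of `ν` together.
  suffices H : symTranslate k c (s, ν) (ket 0 0) ∈ chiralOrbit k c ∧
      ∀ r, symTranslate k c (s, ν + Finsupp.single r 1) (ket 0 0) ∈ chiralOrbit k c from H.1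
  induction ν using finsupp_induction_single with
  | h0 =>
    refine ⟨h, fun r => ?_⟩
    rw [zero_add]
    -- At zero charge `a_0` vanishes and gives nothing, but the symmetrized state with one
    -- oscillator is itself zero.
    rcases eq_or_ne s 0 with rfl | hs
    · rw [symTranslate_vacuum]
      simp
    · obtain ⟨n, hn⟩ := exists_mode_eq_create k c r
      have h1 := mode_mode_mem h n 0
      rw [hn, mode_zero, create_zeroMode_symTranslate_vacuum, Submodule.smul_mem_iff] at h1
      · exact h1
      · refine div_ne_zero ?_ ?_
        · have : (k : ℤ) ≠ 0 := by exact_mod_cast hk.ne'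
          exact_mod_cast mul_ne_zero (mul_ne_zero two_ne_zero this) hs
        · have : 0 < Real.sqrt (2 * k) := Real.sqrt_pos.2 (by positivity)
          exact_mod_cast this.ne'
  | h1 ν r ih =>
    refine ⟨ih.2 r, fun r' => ?_⟩
    obtain ⟨n, hn⟩ := exists_mode_eq_create k c r
    obtain ⟨m, hm⟩ := exists_mode_eq_create k c r'
    rw [← create_create_symTranslate_vacuum, ← hn, ← hm]
    exact mode_mode_mem ih.1 _ _

/-- Without oscillators only the constant term of the annihilation exponential survives, so a single
power of `z` remains. -/
lemma current_sectorState (k : ℕ) (c : Chirality) (ε : ℤˣ) (j s : ℤ) :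
    current k c ε j (sectorState k c (s, 0)) =
      if 0 ≤ -j - k - (ε : ℤ) * (2 * k * s) then
        createExp k c ε (-j - k - (ε : ℤ) * (2 * k * s)).toNat (sectorState k c (s + ε, 0))
      else 0 := by
  rw [sectorState, current_basisState, charge_sector]
  have h : shift k c ε (basisState ((s, c.sign * s * k), embed c 0)) =
    sectorState k c (s + ε, 0) := shift_sectorState k c ε (s, 0)
  simp only [map_zero, level_zero, zero_add, Finset.range_one, Finset.sum_singleton, ← h,
    annihilateExp, expCoeff_zero, Module.End.one_apply, Nat.cast_zero, zero_sub]

lemma createExp_sectorState_mem (k : ℕ) (c : Chirality) (ε : ℤˣ) (N : ℕ) (s : ℤ) :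
    createExp k c ε N (sectorState k c (s, 0)) ∈
      Submodule.span ℂ (Set.range fun ν => sectorState k c (s, ν)) := by
  refine (expCoeff_mem (stabilizer _) _ (fun r => ?_) _ : createExp k c ε _ ∈ _) _
    (Submodule.subset_span ⟨0, rfl⟩)
  refine Subalgebra.smul_mem _ (mem_stabilizer_span ?_) _
  rintro _ ⟨ν, rfl⟩
  simp only [create_sectorState]
  exact Submodule.subset_span ⟨_, rfl⟩

lemma reflection_current (k : ℕ) (c : Chirality) (ε : ℤˣ) (j : ℤ) (v : Fock) :
    reflection (current k c ε j v) = current k c (-ε) j (reflection v) := by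
  have h := LinearMap.congr_fun ((reflection_intertwines k c).current ε j) v
  rw [neg_one_mul] at h
  exact h

lemma add_reflection_mem_chiralOrbit {k : ℕ} {c : Chirality} {s : ℤ}
    (h : ∀ ν, symTranslate k c (s, ν) (ket 0 0) ∈ chiralOrbit k c) {w : Fock}
    (hw : w ∈ Submodule.span ℂ (Set.range fun ν => sectorState k c (s, ν))) :
    w + reflection w ∈ chiralOrbit k c := by
  suffices h : Submodule.span ℂ (Set.range fun ν => sectorState k c (s, ν)) ≤
    (chiralOrbit k c).comap (LinearMap.id + reflection) from h hw
  refine Submodule.span_le.2 ?_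
  rintro _ ⟨ν, rfl⟩
  rw [SetLike.mem_coe, Submodule.mem_comap, LinearMap.add_apply, LinearMap.id_apply,
    ← symTranslate_vacuum_eq_add_reflection]
  exact h ν

lemma symTranslate_zero_mem_chiralOrbit {k : ℕ} (hk : 0 < k) (c : Chirality) (s : ℕ) :
    symTranslate k c (s, 0) (ket 0 0) ∈ chiralOrbit k c := by
  have hket : sectorState k c (0, 0) = ket 0 0 := by simp [sectorState, ket]
  induction s using Nat.strong_induction_on with
  | _ s ih =>
    match s with
    | 0 =>
      rw [symTranslate_vacuum]
      simp only [Nat.cast_zero, neg_zero, hket]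
      exact add_mem (vacuum_mem_chiralOrbit k c)
        (Submodule.smul_mem _ _ (vacuum_mem_chiralOrbit k c))
    | 1 =>
      have h := current_add_current_mem (vacuum_mem_chiralOrbit k c) (-k)
      rw [← hket, current_sectorState, current_sectorState] at h
      simpa [createExp, expCoeff_zero, symTranslate_vacuum] using h
    | s + 2 =>
      -- The mode is chosen so that the `J^+` term from charge `s + 1` has creation order zero and
      -- yields the pure state of charge `s + 2`; the `J^-` term is then a descendant of charge `s`.
      have h := current_add_current_mem (ih (s + 1) (by omega)) (-k - 2 * k * (s + 1 : ℕ))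
      have hp : current k c 1 (-k - 2 * k * (s + 1 : ℕ)) (sectorState k c ((s + 1 : ℕ), 0)) =
          sectorState k c ((s + 2 : ℕ), 0) := by
        rw [current_sectorState]
        have h0 : -(-(k : ℤ) - 2 * k * (s + 1 : ℕ)) - k - ((1 : ℤˣ) : ℤ) * (2 * k * (s + 1 : ℕ)) =
          0 := by simp
        rw [h0, if_pos le_rfl, Int.toNat_zero, createExp, expCoeff_zero, Module.End.one_apply]
        push_cast
        rw [add_assoc]
        rfl
      set w := current k c (-1) (-k - 2 * k * (s + 1 : ℕ)) (sectorState k c ((s + 1 : ℕ), 0))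
        with hw
      have hmem : w ∈ Submodule.span ℂ (Set.range fun ν => sectorState k c ((s : ℕ), ν)) := by
        rw [hw, current_sectorState]
        split_ifs
        · have h1 : ((s + 1 : ℕ) : ℤ) + ((-1 : ℤˣ) : ℤ) = (s : ℕ) := by push_cast; simp
          rw [h1]
          exact createExp_sectorState_mem k c _ _ _
        · exact Submodule.zero_mem _
      have hw' := add_reflection_mem_chiralOrbit
        (symTranslate_mem_chiralOrbit hk (ih s (by omega))) hmem
      -- As the reflection exchanges `J^+` and `J^-`, the four terms regroup as `p + reflection p`
      -- and `w + reflection w`, with `p` the state of charge `s + 2`.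
      rw [symTranslate_vacuum_eq_add_reflection, map_add, map_add,
        ← neg_neg (1 : ℤˣ), ← reflection_current, neg_neg, ← reflection_current, hp, ← hw] at h
      rw [symTranslate_vacuum_eq_add_reflection]
      have := sub_mem h hw'
      convert this using 1
      abel

lemma symTranslate_neg (k : ℕ) (c : Chirality) (s : ℤ) (ν : ℕ+ →₀ ℕ) :
    symTranslate k c (-s, ν) = ((-1 : ℂ) ^ ν.degree) • symTranslate k c (s, ν) := by
  simp only [symTranslate, smul_add, smul_smul, ← mul_pow, neg_neg]
  simp [add_comm]

theorem symTranslate_vacuum_mem_chiralOrbit {k : ℕ} (hk : 0 < k) (c : Chirality)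
    (x : ℤ × (ℕ+ →₀ ℕ)) : symTranslate k c x (ket 0 0) ∈ chiralOrbit k c := by
  obtain ⟨s, ν⟩ := x
  have h (n : ℕ) := symTranslate_mem_chiralOrbit hk (symTranslate_zero_mem_chiralOrbit hk c n) ν
  obtain ⟨n, rfl | rfl⟩ := Int.eq_nat_or_neg s
  · exact h n
  · rw [symTranslate_neg]
    exact Submodule.smul_mem _ _ (h n)

/-- If `A` produces the left state and `B` the right one from the vacuum, then `B * A` produces
their product, because `B` commutes with the left symmetrized translation. -/
theorem symFock_le {k : ℕ} (hk : 0 < k) : symFock k ≤ generatedFrom k (ket 0 0) := by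
  refine Submodule.span_le.2 ?_
  rintro _ ⟨⟨x, y⟩, rfl⟩
  obtain ⟨A, hA, hAx⟩ := mem_chiralOrbit.1 (symTranslate_vacuum_mem_chiralOrbit hk .left x)
  obtain ⟨B, hB, hBy⟩ := mem_chiralOrbit.1 (symTranslate_vacuum_mem_chiralOrbit hk .right y)
  have hcomm : B ∈ Subalgebra.centralizer ℂ {symTranslate k .left x} := by
    refine Algebra.adjoin_le (fun C hC => ?_) hB
    rw [SetLike.mem_coe, Subalgebra.mem_centralizer_iff]
    rintro _ rfl
    exact (commute_symTranslate (c := .left) (by decide) x hC).eq.symm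
  have hcomm' := LinearMap.congr_fun
    ((Subalgebra.mem_centralizer_iff ℂ).1 hcomm _ (Set.mem_singleton _)) (ket 0 0)
  rw [Module.End.mul_apply, Module.End.mul_apply, hBy, ← hAx] at hcomm'
  have hsub (c : Chirality) : Algebra.adjoin ℂ (chiralModeSet k c) ≤ symmetryAlgebra k :=
    Algebra.adjoin_mono fun C hC => mem_modeSet.2 ⟨c, hC⟩
  exact ⟨B * A, (mul_mem (hsub _ hB) (hsub _ hA) : B * A ∈ symmetryAlgebra k), hcomm'.symm⟩

theorem generatedFrom_eq {k : ℕ} (hk : 0 < k) : generatedFrom k (ket 0 0) = symFock k :=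
  le_antisymm (generatedFrom_le k) (symFock_le hk)

/-! ### The vacuum module as a tensor product of symmetrized sectors -/

/-- The symmetrization of a basis state under the reflections of both chiralities. -/
def symState (k : ℕ) (x y : ℤ × (ℕ+ →₀ ℕ)) : Fock :=
  symTranslate k .left x (symTranslate k .right y (ket 0 0))

lemma symState_mem_symFock (k : ℕ) (x y : ℤ × (ℕ+ →₀ ℕ)) : symState k x y ∈ symFock k :=
  symTranslate_mem_symFock k x y

lemma symState_eq (k : ℕ) (s s' : ℤ) (ν ν' : ℕ+ →₀ ℕ) :
    symState k (s, ν) (s', ν') =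
      basisState ((s + s', k * (s - s')), embed .left ν + embed .right ν') +
      ((-1 : ℂ) ^ ν.degree * (-1 : ℂ) ^ ν'.degree) •
        basisState ((-(s + s'), -(k * (s - s'))), embed .left ν + embed .right ν') +
      ((-1 : ℂ) ^ ν'.degree) •
        basisState ((s - s', k * (s + s')), embed .left ν + embed .right ν') +
      ((-1 : ℂ) ^ ν.degree) •
        basisState ((-(s - s'), -(k * (s + s'))), embed .left ν + embed .right ν') := by
  have h1 : (s' + s, Chirality.right.sign * s' * k + Chirality.left.sign * s * k) =
      (s + s', (k : ℤ) * (s - s')) := by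
    ext <;> simp [Chirality.sign] <;> ring
  have h2 : (s' + -s, Chirality.right.sign * s' * k + Chirality.left.sign * -s * k) =
      (-(s - s'), -((k : ℤ) * (s + s'))) := by
    ext <;> simp [Chirality.sign] <;> ring
  have h3 : (-s' + s, Chirality.right.sign * -s' * k + Chirality.left.sign * s * k) =
      (s - s', (k : ℤ) * (s + s')) := by
    ext <;> simp [Chirality.sign] <;> ring
  have h4 : (-s' + -s, Chirality.right.sign * -s' * k + Chirality.left.sign * -s * k) =
      (-(s + s'), -((k : ℤ) * (s - s'))) := by
    ext <;> simp [Chirality.sign]; ring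
  rw [symState, symTranslate_vacuum, map_add, map_smul]
  simp only [symTranslate, LinearMap.add_apply, LinearMap.smul_apply, sectorState,
    translate_basisState, h1, h2, h3, h4, smul_add, smul_smul]
  rw [add_comm (embed .right ν') (embed .left ν), mul_comm ((-1 : ℂ) ^ ν'.degree)]
  abel

/-- Occupation numbers of the oscillators in a list. -/
def occupation (l : List ℕ+) : ℕ+ →₀ ℕ := (l.map fun r => Finsupp.single r 1).sum

lemma occupation_cons (r : ℕ+) (l : List ℕ+) :
    occupation (r :: l) = occupation l + Finsupp.single r 1 := by
  simp [occupation, add_comm]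

lemma degree_occupation (l : List ℕ+) : (occupation l).degree = l.length := by
  induction l with
  | nil => simp [occupation]
  | cons r l ih => simp [occupation_cons, ih]

lemma exists_occupation_eq (ν : ℕ+ →₀ ℕ) : ∃ l, occupation l = ν := by
  induction ν using finsupp_induction_single with
  | h0 => exact ⟨[], rfl⟩
  | h1 ν r ih =>
    obtain ⟨l, rfl⟩ := ih
    exact ⟨r :: l, occupation_cons r l⟩

lemma prod_create_basisState (c : Chirality) (l : List ℕ+) (b : Label) :
    (l.map (create c)).prod (basisState b) = basisState (b.1, b.2 + embed c (occupation l)) := by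
  induction l with
  | nil => simp [occupation]
  | cons r l ih =>
    rw [List.map_cons, List.prod_cons, Module.End.mul_apply, ih, create_basisState,
      occupation_cons, map_add, embed_single, add_assoc]

/-- The operator creating the oscillators in two lists. -/
def excite (l l' : List ℕ+) : Module.End ℂ Fock :=
  (l.map (create .left)).prod * (l'.map (create .right)).prod

lemma excite_ket (l l' : List ℕ+) (m n : ℤ) :
    excite l l' (ket m n) =
      basisState ((m, n), embed .left (occupation l) + embed .right (occupation l')) := by
  rw [excite, Module.End.mul_apply, ket, prod_create_basisState, prod_create_basisState, zero_add,
    add_comm]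

lemma excite_eq_symState (k : ℕ) (l l' : List ℕ+) (s s' : ℤ) :
    excite l l' (ket (s + s') (k * (s - s')) +
      ((-1 : ℂ) ^ l.length * (-1 : ℂ) ^ l'.length) • ket (-(s + s')) (-(k * (s - s'))) +
      ((-1 : ℂ) ^ l'.length) • ket (s - s') (k * (s + s')) +
      ((-1 : ℂ) ^ l.length) • ket (-(s - s')) (-(k * (s + s')))) =
    symState k (s, occupation l) (s', occupation l') := by
  simp only [map_add, map_smul, excite_ket, symState_eq, degree_occupation]

lemma excitations_le {P P' : ℕ → Prop} {v : Fock} {N : Submodule ℂ Fock} :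
    excitations P P' v ≤ N ↔ ∀ l l', P l.length → P' l'.length → excite l l' v ∈ N := by
  rw [excitations, Submodule.span_le]
  constructor
  · intro h l l' hl hl'
    exact h ⟨l, l', hl, hl', rfl⟩
  · rintro h _ ⟨l, l', hl, hl', rfl⟩
    exact h l l' hl hl'

/-- The parities of the two lists determine the signs in `symState_eq`, one parity pair for each of
the four summands. -/
lemma vacuumPart_le (k : ℕ) (s s' : ℤ) : vacuumPart k s s' ≤ symFock k := by
  refine sup_le (sup_le (sup_le ?_ ?_) ?_) ?_ <;> refine excitations_le.2 fun l l' hl hl' => ?_ <;>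
  · have h := symState_mem_symFock k (s, occupation l) (s', occupation l')
    rw [← excite_eq_symState, hl.neg_one_pow, hl'.neg_one_pow] at h
    simpa only [mul_one, mul_neg, neg_neg, neg_smul, one_smul, ← sub_eq_add_neg] using h

lemma vacuumPartLeft_le (k : ℕ) (s : ℤ) : vacuumPartLeft k s ≤ symFock k := by
  refine sup_le ?_ ?_ <;> refine excitations_le.2 fun l l' hl hl' => ?_ <;>
  · have h := symState_mem_symFock k (s, occupation l) (0, occupation l')
    rw [← excite_eq_symState, hl.neg_one_pow, hl'.neg_one_pow] at h
    simp only [mul_one, neg_smul, one_smul, add_zero, sub_zero] at h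
    -- With one charge zero the four terms coincide in pairs, so the symmetrized state is twice the
    -- required one; with both zero the factor is four.
    rw [← Submodule.smul_mem_iff _ (two_ne_zero (α := ℂ)), ← map_smul, two_smul]
    convert h using 2
    abel

lemma vacuumPartRight_le (k : ℕ) (s' : ℤ) : vacuumPartRight k s' ≤ symFock k := by
  refine sup_le ?_ ?_ <;> refine excitations_le.2 fun l l' hl hl' => ?_ <;>
  · have h := symState_mem_symFock k (0, occupation l) (s', occupation l')
    rw [← excite_eq_symState, hl.neg_one_pow, hl'.neg_one_pow] at h
    simp only [one_mul, neg_smul, one_smul, zero_add, zero_sub, mul_neg, neg_neg] at h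
    rw [← Submodule.smul_mem_iff _ (two_ne_zero (α := ℂ)), ← map_smul, two_smul]
    convert h using 2
    abel

lemma excitations_vacuum_le (k : ℕ) : excitations Even Even (ket 0 0) ≤ symFock k := by
  refine excitations_le.2 fun l l' hl hl' => ?_
  have h := symState_mem_symFock k (0, occupation l) (0, occupation l')
  rw [← excite_eq_symState, hl.neg_one_pow, hl'.neg_one_pow] at h
  simp only [mul_one, one_smul, add_zero, sub_zero, mul_zero, neg_zero] at h
  rw [← Submodule.smul_mem_iff _ (show (4 : ℂ) ≠ 0 by norm_num), ← map_smul]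
  convert h using 2
  module

theorem vacuumModule_le (k : ℕ) : vacuumModule k ≤ symFock k :=
  sup_le (sup_le (sup_le
    (iSup₂_le fun _ _ => iSup₂_le fun _ _ => vacuumPart_le k _ _)
    (iSup₂_le fun _ _ => vacuumPartLeft_le k _))
    (iSup₂_le fun _ _ => vacuumPartRight_le k _)) (excitations_vacuum_le k)

/-- The labels of a basis of the reflection invariant part of one chiral sector. -/
abbrev SymLabel := {x : ℕ × (ℕ+ →₀ ℕ) // x.1 = 0 → Even x.2.degree}

/-- The element of the basis of the vacuum module with given labels. -/
def vacuumBasis (k : ℕ) (i : SymLabel × SymLabel) : Fock :=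
  symState k (i.1.1.1, i.1.1.2) (i.2.1.1, i.2.1.2)

lemma exists_symTranslate_eq_smul (k : ℕ) (c : Chirality) (x : ℤ × (ℕ+ →₀ ℕ)) :
    ∃ (a : ℂ) (i : SymLabel), symTranslate k c x = a • symTranslate k c (i.1.1, i.1.2) := by
  obtain ⟨s, ν⟩ := x
  rcases eq_or_ne s 0 with rfl | hs
  · rcases Nat.even_or_odd ν.degree with h | h
    · exact ⟨1, ⟨(0, ν), fun _ => h⟩, by simp⟩
    · refine ⟨0, ⟨(0, 0), fun _ => by simp⟩, ?_⟩
      refine LinearMap.ext fun v => ?_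
      simp [symTranslate, h.neg_one_pow]
  · obtain ⟨n, rfl | rfl⟩ := Int.eq_nat_or_neg s
    · exact ⟨1, ⟨(n, ν), fun h => absurd h (by simpa using hs)⟩, by simp⟩
    · exact ⟨_, ⟨(n, ν), fun h => absurd h (by simpa using hs)⟩, symTranslate_neg k c n ν⟩

theorem symFock_eq_span (k : ℕ) : symFock k = Submodule.span ℂ (Set.range (vacuumBasis k)) := by
  refine le_antisymm (Submodule.span_le.2 ?_) (Submodule.span_le.2 ?_)
  · rintro _ ⟨⟨x, y⟩, rfl⟩
    obtain ⟨a, i, hi⟩ := exists_symTranslate_eq_smul k .left x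
    obtain ⟨b, j, hj⟩ := exists_symTranslate_eq_smul k .right y
    simp only [hi, hj, LinearMap.smul_apply, map_smul]
    exact Submodule.smul_mem _ _ (Submodule.smul_mem _ _ (Submodule.subset_span ⟨(i, j), rfl⟩))
  · rintro _ ⟨i, rfl⟩
    exact symState_mem_symFock k _ _

lemma vacuumPart_le_vacuumModule (k : ℕ) {s s' : ℤ} (hs : 0 < s) (hs' : 0 < s') :
    vacuumPart k s s' ≤ vacuumModule k :=
  le_sup_of_le_left (le_sup_of_le_left (le_sup_of_le_left
    (le_iSup₂_of_le s hs (le_iSup₂_of_le s' hs' le_rfl))))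

lemma vacuumPartLeft_le_vacuumModule (k : ℕ) {s : ℤ} (hs : 0 < s) :
    vacuumPartLeft k s ≤ vacuumModule k :=
  le_sup_of_le_left (le_sup_of_le_left (le_sup_of_le_right (le_iSup₂_of_le s hs le_rfl)))

lemma vacuumPartRight_le_vacuumModule (k : ℕ) {s' : ℤ} (hs' : 0 < s') :
    vacuumPartRight k s' ≤ vacuumModule k :=
  le_sup_of_le_left (le_sup_of_le_right (le_iSup₂_of_le s' hs' le_rfl))

lemma excite_mem {P P' : ℕ → Prop} {v : Fock} {N : Submodule ℂ Fock}
    (h : excitations P P' v ≤ N) {l l' : List ℕ+} (hl : P l.length) (hl' : P' l'.length) :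
    excite l l' v ∈ N :=
  excitations_le.1 h l l' hl hl'

lemma symState_mem_vacuumModule_of_pos (k : ℕ) {s s' : ℤ} (hs : 0 < s) (hs' : 0 < s')
    (l l' : List ℕ+) : symState k (s, occupation l) (s', occupation l') ∈ vacuumModule k := by
  have h := vacuumPart_le_vacuumModule k hs hs'
  rw [vacuumPart, sup_le_iff, sup_le_iff, sup_le_iff] at h
  obtain ⟨⟨⟨h1, h2⟩, h3⟩, h4⟩ := h
  rw [← excite_eq_symState]
  rcases Nat.even_or_odd l.length with hl | hl <;>
  rcases Nat.even_or_odd l'.length with hl' | hl' <;>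
  rw [hl.neg_one_pow, hl'.neg_one_pow] <;>
  simp only [mul_one, mul_neg, neg_neg, neg_smul, one_smul, ← sub_eq_add_neg]
  · exact excite_mem h1 hl hl'
  · exact excite_mem h4 hl hl'
  · exact excite_mem h3 hl hl'
  · exact excite_mem h2 hl hl'

lemma symState_mem_vacuumModule_left (k : ℕ) {s : ℤ} (hs : 0 < s)
    (l l' : List ℕ+) (hl' : Even l'.length) :
    symState k (s, occupation l) (0, occupation l') ∈ vacuumModule k := by
  have h := vacuumPartLeft_le_vacuumModule k hs
  rw [vacuumPartLeft, sup_le_iff] at h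
  rw [← excite_eq_symState, hl'.neg_one_pow]
  simp only [mul_one, one_smul, add_zero, sub_zero]
  rcases Nat.even_or_odd l.length with hl | hl <;> rw [hl.neg_one_pow]
  · convert Submodule.smul_mem _ (2 : ℂ) (excite_mem h.1 hl hl') using 1
    rw [← map_smul]
    congr 1
    module
  · convert Submodule.smul_mem _ (2 : ℂ) (excite_mem h.2 hl hl') using 1
    rw [← map_smul]
    congr 1
    module

lemma symState_mem_vacuumModule_right (k : ℕ) {s' : ℤ} (hs' : 0 < s')
    (l l' : List ℕ+) (hl : Even l.length) :
    symState k (0, occupation l) (s', occupation l') ∈ vacuumModule k := by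
  have h := vacuumPartRight_le_vacuumModule k hs'
  rw [vacuumPartRight, sup_le_iff] at h
  rw [← excite_eq_symState, hl.neg_one_pow]
  simp only [one_mul, one_smul, zero_add, zero_sub, mul_neg, neg_neg]
  rcases Nat.even_or_odd l'.length with hl' | hl' <;> rw [hl'.neg_one_pow]
  · convert Submodule.smul_mem _ (2 : ℂ) (excite_mem h.1 hl hl') using 1
    rw [← map_smul]
    congr 1
    module
  · convert Submodule.smul_mem _ (2 : ℂ) (excite_mem h.2 hl hl') using 1
    rw [← map_smul]
    congr 1
    module

lemma symState_mem_vacuumModule_zero (k : ℕ) (l l' : List ℕ+) (hl : Even l.length)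
    (hl' : Even l'.length) :
    symState k (0, occupation l) (0, occupation l') ∈ vacuumModule k := by
  have h : excitations Even Even (ket 0 0) ≤ vacuumModule k := le_sup_right
  rw [← excite_eq_symState, hl.neg_one_pow, hl'.neg_one_pow]
  simp only [mul_one, one_smul, add_zero, sub_zero, mul_zero, neg_zero]
  convert Submodule.smul_mem _ (4 : ℂ) (excite_mem h hl hl') using 1
  rw [← map_smul]
  congr 1
  module

theorem vacuumModule_eq_symFock (k : ℕ) : vacuumModule k = symFock k := by
  refine le_antisymm (vacuumModule_le k) ?_
  rw [symFock_eq_span]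
  refine Submodule.span_le.2 ?_
  rintro _ ⟨⟨⟨⟨s, ν⟩, hs⟩, ⟨⟨s', ν'⟩, hs'⟩⟩, rfl⟩
  obtain ⟨l, rfl⟩ := exists_occupation_eq ν
  obtain ⟨l', rfl⟩ := exists_occupation_eq ν'
  simp only [degree_occupation] at hs hs'
  simp only [vacuumBasis]
  rcases Nat.eq_zero_or_pos s with rfl | h <;> rcases Nat.eq_zero_or_pos s' with rfl | h'
  · exact symState_mem_vacuumModule_zero k l l' (hs rfl) (hs' rfl)
  · exact symState_mem_vacuumModule_right k (by exact_mod_cast h') l l' (hs rfl)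
  · exact symState_mem_vacuumModule_left k (by exact_mod_cast h) l l' (hs' rfl)
  · exact symState_mem_vacuumModule_of_pos k (by exact_mod_cast h) (by exact_mod_cast h') l l'

/-! ### Traces of diagonal operators -/

section Trace

variable {V ι : Type*} [AddCommGroup V] [Module ℂ V]

/-- Applying `T - x` to an expansion in the `v i` multiplies the coefficients by `e i - x`;
independence forces `e i = x` wherever the coefficient is nonzero. -/
lemma eigenspace_inf_span {T : Module.End ℂ V} {v : ι → V} {e : ι → ℝ}
    (hv : LinearIndependent ℂ v) (hT : ∀ i, T (v i) = (e i : ℂ) • v i) (x : ℝ) :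
    Submodule.span ℂ (Set.range v) ⊓ T.eigenspace (x : ℂ) =
      Submodule.span ℂ (Set.range fun i : {i // e i = x} => v i) := by
  refine le_antisymm ?_ (Submodule.span_le.2 ?_)
  · rintro w ⟨hw, hx⟩
    obtain ⟨a, rfl⟩ := (Finsupp.mem_span_range_iff_exists_finsupp).1 hw
    rw [SetLike.mem_coe, Module.End.mem_eigenspace_iff] at hx
    have h0 : a.sum (fun i z => (z * ((e i : ℂ) - x)) • v i) = 0 := by
      rw [← sub_eq_zero] at hx
      rw [← hx, map_finsuppSum, Finsupp.smul_sum, ← Finsupp.sum_sub]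
      refine Finsupp.sum_congr fun i _ => ?_
      rw [map_smul, hT, mul_sub, sub_smul, smul_smul, smul_smul, mul_comm (x : ℂ)]
    have h1 := linearIndependent_iff'.1 hv a.support (fun i => a i * ((e i : ℂ) - x)) h0
    refine Submodule.sum_mem _ fun i hi => Submodule.smul_mem _ _ (Submodule.subset_span ?_)
    refine ⟨⟨i, ?_⟩, rfl⟩
    have h2 := (mul_eq_zero.1 (h1 i hi)).resolve_left (Finsupp.mem_support_iff.1 hi)
    exact_mod_cast sub_eq_zero.1 h2
  · rintro _ ⟨⟨i, rfl⟩, rfl⟩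
    exact ⟨Submodule.subset_span ⟨i, rfl⟩, Module.End.mem_eigenspace_iff.2 (hT i)⟩

theorem hasPowTrace_span {T : Module.End ℂ V} {v : ι → V} {e : ι → ℝ}
    (hv : LinearIndependent ℂ v) (hT : ∀ i, T (v i) = (e i : ℂ) • v i) {q t : ℝ} (hq : 0 < q)
    (hs : HasSum (fun i => q ^ e i) t) :
    HasPowTrace T (Submodule.span ℂ (Set.range v)) q t := by
  -- On a fibre of `e` the summand is the positive constant `q ^ x`, so summability already forces
  -- the fibre to be finite.
  have hfin (x : ℝ) : Finite {i // e i = x} := by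
    have h : Summable fun _ : {i // e i = x} => q ^ x :=
      (hs.summable.subtype {i | e i = x}).congr (g := fun _ => q ^ x)
      (fun i => by simp only [Function.comp_apply]; rw [i.2])
    by_contra hinf
    rw [not_finite_iff_infinite] at hinf
    exact (Real.rpow_pos_of_pos hq x).ne' ((summable_const_iff _).1 h)
  refine ⟨fun w hw => ?_, le_antisymm (iSup_le fun x => inf_le_left) (Submodule.span_le.2 ?_),
    fun x => ?_, ?_⟩
  · refine (Submodule.span_le (p := (Submodule.span ℂ (Set.range v)).comap T)).2 ?_ hw
    rintro _ ⟨i, rfl⟩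
    rw [SetLike.mem_coe, Submodule.mem_comap, hT]
    exact Submodule.smul_mem _ _ (Submodule.subset_span ⟨i, rfl⟩)
  · rintro _ ⟨i, rfl⟩
    refine Submodule.mem_iSup_of_mem (e i) ⟨Submodule.subset_span ⟨i, rfl⟩, ?_⟩
    exact Module.End.mem_eigenspace_iff.2 (hT i)
  · rw [eigenspace_inf_span hv hT]
    have := hfin x
    exact FiniteDimensional.span_of_finite ℂ (Set.finite_range _)
  · refine (hs.tsum_fiberwise e).congr_fun fun x => ?_
    rw [eigenspace_inf_span hv hT]
    have := Fintype.ofFinite {i // e i = x}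
    have hc : LinearIndependent ℂ fun i : {i // e i = x} => v i :=
      hv.comp _ Subtype.val_injective
    rw [finrank_span_eq_card hc]
    rw [tsum_congr (g := fun _ : e ⁻¹' {x} => q ^ x) (fun i => by rw [i.2])]
    rw [tsum_const, nsmul_eq_mul, ← Nat.card_eq_fintype_card]
    rfl

end Trace

/-! ### The basis of the vacuum module -/

/-- The basis label of `|s, s'⟩_*` with given oscillators. -/
def pairLabel (k : ℕ) (s s' : ℤ) (ν ν' : ℕ+ →₀ ℕ) : Label :=
  ((s + s', k * (s - s')), embed .left ν + embed .right ν')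

lemma pairLabel_inj {k : ℕ} (hk : 0 < k) {s s' t t' : ℤ} {ν ν' ξ ξ' : ℕ+ →₀ ℕ} :
    pairLabel k s s' ν ν' = pairLabel k t t' ξ ξ' ↔ s = t ∧ s' = t' ∧ ν = ξ ∧ ν' = ξ' := by
  constructor
  · intro h
    have h1 : s + s' = t + t' := congrArg (fun b : Label => b.1.1) h
    have h2 : (k : ℤ) * (s - s') = k * (t - t') := congrArg (fun b : Label => b.1.2) h
    have h3 : embed .left ν + embed .right ν' = embed .left ξ + embed .right ξ' :=
      congrArg (fun b : Label => b.2) h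
    have h2' := mul_left_cancel₀ (by exact_mod_cast hk.ne') h2
    refine ⟨by omega, by omega, ?_, ?_⟩ <;> ext r
    · have := DFunLike.congr_fun h3 (.left, r)
      simpa [embed_apply_same, embed_apply_ne (c := .right) (c' := .left)] using this
    · have := DFunLike.congr_fun h3 (.right, r)
      simpa [embed_apply_same, embed_apply_ne (c := .left) (c' := .right)] using this
  · rintro ⟨rfl, rfl, rfl, rfl⟩
    rfl

lemma symState_eq_pairLabel (k : ℕ) (s s' : ℤ) (ν ν' : ℕ+ →₀ ℕ) :
    symState k (s, ν) (s', ν') =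
      basisState (pairLabel k s s' ν ν') +
      ((-1 : ℂ) ^ ν.degree * (-1 : ℂ) ^ ν'.degree) • basisState (pairLabel k (-s) (-s') ν ν') +
      ((-1 : ℂ) ^ ν'.degree) • basisState (pairLabel k s (-s') ν ν') +
      ((-1 : ℂ) ^ ν.degree) • basisState (pairLabel k (-s) s' ν ν') := by
  rw [symState_eq]
  have h1 : -(s + s') = -s + -s' := by ring
  have h3 : -(s - s') = -s + s' := by ring
  have h4 : -((k : ℤ) * (s + s')) = k * (-s - s') := by ring
  simp only [pairLabel, ← h1, ← h3, ← h4, mul_neg, sub_neg_eq_add, ← sub_eq_add_neg]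

lemma basisState_apply (b b' : Label) : basisState b b' = if b = b' then 1 else 0 := by
  rw [basisState, Finsupp.single_apply]

theorem linearIndependent_vacuumBasis {k : ℕ} (hk : 0 < k) :
    LinearIndependent ℂ (vacuumBasis k) := by
  let b (i : SymLabel × SymLabel) : Label := pairLabel k i.1.1.1 i.2.1.1 i.1.1.2 i.2.1.2
  -- The coefficient at the label with nonnegative charges is 1, 2 or 4: the evenness condition at
  -- zero charge keeps coinciding terms from cancelling.
  have hne (i) : vacuumBasis k i (b i) ≠ 0 := by
    obtain ⟨⟨⟨s, ν⟩, hs⟩, ⟨⟨s', ν'⟩, hs'⟩⟩ := i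
    simp only [vacuumBasis, symState_eq_pairLabel, b, Finsupp.add_apply, Finsupp.smul_apply,
      basisState_apply, pairLabel_inj hk, and_true, neg_eq_self, Nat.cast_eq_zero, smul_eq_mul,
      true_and]
    rcases eq_or_ne s 0 with h | h <;> rcases eq_or_ne s' 0 with h' | h'
    · rw [(hs h).neg_one_pow, (hs' h').neg_one_pow]
      norm_num [h, h']
    · rw [(hs h).neg_one_pow]
      norm_num [h, h']
    · rw [(hs' h').neg_one_pow]
      norm_num [h, h']
    · norm_num [h, h']
  refine LinearIndependent.of_pairwise_dual_eq_zero_one _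
    (fun i => (vacuumBasis k i (b i))⁻¹ • Finsupp.lapply (b i)) (fun i j hij => ?_) fun i => ?_
  · obtain ⟨⟨⟨s, ν⟩, hs⟩, ⟨⟨s', ν'⟩, hs'⟩⟩ := i
    obtain ⟨⟨⟨t, ξ⟩, ht⟩, ⟨⟨t', ξ'⟩, ht'⟩⟩ := j
    have hij' : ¬ (ξ = ν ∧ ξ' = ν' ∧ s = t ∧ s' = t') := by
      rintro ⟨rfl, rfl, rfl, rfl⟩
      exact hij rfl
    -- Natural numbers that agree up to sign are equal, so this label occurs in no other basis
    -- element.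
    have h0 (u u' : ℤ) (hu : u = t ∨ u = -t) (hu' : u' = t' ∨ u' = -t') :
        basisState (pairLabel k u u' ξ ξ') (pairLabel k s s' ν ν') = 0 := by
      rw [basisState_apply, if_neg]
      rw [pairLabel_inj hk]
      rintro ⟨h1, h2, h3, h4⟩
      exact hij' ⟨h3, h4, by omega, by omega⟩
    rw [LinearMap.smul_apply, Finsupp.lapply_apply, smul_eq_mul]
    refine mul_eq_zero_of_right _ ?_
    simp only [vacuumBasis, symState_eq_pairLabel, b, Finsupp.add_apply, Finsupp.smul_apply]
    rw [h0 _ _ (.inl rfl) (.inl rfl), h0 _ _ (.inr rfl) (.inr rfl), h0 _ _ (.inl rfl) (.inr rfl),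
      h0 _ _ (.inr rfl) (.inl rfl)]
    simp
  · rw [LinearMap.smul_apply, Finsupp.lapply_apply, smul_eq_mul, inv_mul_cancel₀ (hne i)]

/-! ### The energy of the basis states -/

lemma virasoroZero_basisState (k : ℕ) (c : Chirality) (b : Label) :
    virasoroZero k c (basisState b) =
      ((charge k c b.1 : ℂ) ^ 2 / (4 * k) + level c b.2) • basisState b := by
  rw [virasoroZero, linearCombination_basisState, add_smul]
  congr 1
  · rw [Module.End.mul_apply, zeroMode_basisState, map_smul, zeroMode_basisState, smul_smul,
      smul_smul]
    congr 1
    have h : ((Real.sqrt (2 * k) : ℝ) : ℂ) ^ 2 = 2 * k := by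
      rw [← Complex.ofReal_pow, Real.sq_sqrt (by positivity)]
      push_cast
      rfl
    rw [mul_assoc, ← sq, div_pow, h, one_div, div_eq_mul_inv, div_eq_mul_inv, mul_inv, mul_inv]
    ring
  · rw [level, Finsupp.sum, Nat.cast_sum, Finset.sum_smul]
    refine Finset.sum_congr rfl fun i hi => ?_
    split_ifs with h
    · subst h
      have h1 : b.2 - Finsupp.single i 1 + Finsupp.single i 1 = b.2 := by
        refine tsub_add_cancel_of_le ?_
        rw [Finsupp.single_le_iff]
        exact Nat.one_le_iff_ne_zero.2 (Finsupp.mem_support_iff.1 hi)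
      rw [Module.End.mul_apply, annihilate_basisState, map_smul, create_basisState, h1]
      push_cast
      rfl
    · simp

/-- The energy `∑_r r ν_r` of the oscillators `ν`. -/
def weight (ν : ℕ+ →₀ ℕ) : ℕ := ν.sum fun r n => (r : ℕ) * n

lemma level_embed_same (c : Chirality) (ν : ℕ+ →₀ ℕ) : level c (embed c ν) = weight ν := by
  induction ν using finsupp_induction_single with
  | h0 => simp [weight]
  | h1 ν r ih =>
    rw [map_add, level_add, ih, embed_single, level_single, weight, weight,
      Finsupp.sum_add_index' (by simp) (by intros; ring), Finsupp.sum_single_index (by simp)]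
    simp

/-- The charges are `2ks` and `2ks'`, and `(2ks)² / (4k) = ks²`. The energy is even in `s` and `s'`,
hence common to the four terms of a symmetrized state. -/
lemma hamiltonian_pairLabel {k : ℕ} (hk : 0 < k) (s s' : ℤ) (ν ν' : ℕ+ →₀ ℕ) :
    hamiltonian k (basisState (pairLabel k s s' ν ν')) =
      ((k : ℂ) * s ^ 2 + weight ν + (k * s' ^ 2 + weight ν') - 1 / 12) •
        basisState (pairLabel k s s' ν ν') := by
  have hk' : (k : ℂ) ≠ 0 := by exact_mod_cast hk.ne'
  rw [hamiltonian, LinearMap.sub_apply, LinearMap.add_apply, virasoroZero_basisState,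
    virasoroZero_basisState, LinearMap.smul_apply, Module.End.one_apply, ← add_smul, ← sub_smul]
  congr 1
  simp only [pairLabel, level_add, level_embed_same, charge, Chirality.sign]
  rw [level_embed_ne (by decide), level_embed_ne (by decide)]
  push_cast
  field_simp
  ring

/-- The energy of one chirality of a state in the basis of the vacuum module. -/
def chiralEnergy (k : ℕ) (x : SymLabel) : ℝ := (k * x.1.1 ^ 2 + weight x.1.2 : ℕ) - 1 / 24

lemma hamiltonian_vacuumBasis {k : ℕ} (hk : 0 < k) (i : SymLabel × SymLabel) :
    hamiltonian k (vacuumBasis k i) =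
      ((chiralEnergy k i.1 + chiralEnergy k i.2 : ℝ) : ℂ) • vacuumBasis k i := by
  obtain ⟨⟨⟨s, ν⟩, hs⟩, ⟨⟨s', ν'⟩, hs'⟩⟩ := i
  have h : ((chiralEnergy k ⟨(s, ν), hs⟩ + chiralEnergy k ⟨(s', ν'), hs'⟩ : ℝ) : ℂ) =
      (k : ℂ) * s ^ 2 + weight ν + (k * s' ^ 2 + weight ν') - 1 / 12 := by
    simp only [chiralEnergy]
    push_cast
    ring
  simp only [h, vacuumBasis, symState_eq_pairLabel, map_add, map_smul, hamiltonian_pairLabel hk,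
    Int.cast_neg, neg_sq, Int.cast_natCast, smul_add]
  simp only [smul_comm ((-1 : ℂ) ^ _), smul_comm ((-1 : ℂ) ^ _ * (-1) ^ _)]

lemma hasSum_mul_prod {α β : Type*} {f : α → ℝ} {g : β → ℝ} {a b : ℝ} (hf : HasSum f a)
    (hg : HasSum g b) : HasSum (fun x : α × β => f x.1 * g x.2) (a * b) :=
  hf.mul hg (summable_mul_of_summable_norm hf.summable.norm hg.summable.norm)

theorem hasPowTrace_vacuumModule {k : ℕ} (hk : 0 < k) {q t : ℝ} (hq : 0 < q)
    (hs : HasSum (fun x => q ^ chiralEnergy k x) t) :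
    HasPowTrace (hamiltonian k) (vacuumModule k) q (t ^ 2) := by
  have h := hasSum_mul_prod hs hs
  simp only [← Real.rpow_add hq, ← pow_two] at h
  rw [vacuumModule_eq_symFock, symFock_eq_span]
  exact hasPowTrace_span (linearIndependent_vacuumBasis hk) (hamiltonian_vacuumBasis hk) hq h

/-! ### Sums over occupation numbers -/

section OccupationSum

variable {ι : Type*}

/-- Occupation numbers on `insert a s` split into the one at `a` and the ones on `s`. -/
def insertSupportEquiv [DecidableEq ι] {a : ι} {s : Finset ι} (ha : a ∉ s) :
    ℕ × {μ : ι →₀ ℕ // μ.support ⊆ s} ≃ {μ : ι →₀ ℕ // μ.support ⊆ insert a s} where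
  toFun x := ⟨x.2.1 + Finsupp.single a x.1, by
    refine Finsupp.support_add.trans (Finset.union_subset
      (x.2.2.trans (Finset.subset_insert a s)) ?_)
    exact Finsupp.support_single_subset.trans (by simp)⟩
  invFun μ := (μ.1 a, ⟨μ.1.erase a, by
    rw [Finsupp.support_erase]
    exact (Finset.erase_subset_erase a μ.2).trans (Finset.erase_insert_subset a s)⟩)
  left_inv := by
    rintro ⟨n, μ, hμ⟩
    have h0 : μ a = 0 := Finsupp.notMem_support_iff.1 fun h => ha (hμ h)
    have h1 : (μ + Finsupp.single a n).erase a = μ := by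
      rw [Finsupp.erase_add, Finsupp.erase_single, add_zero,
        Finsupp.erase_of_notMem_support (Finsupp.notMem_support_iff.2 h0)]
    simp [h0, h1]
  right_inv := by
    rintro ⟨μ, hμ⟩
    simp [Finsupp.erase_add_single]

lemma prod_pow_add_single (x : ι → ℝ) (μ : ι →₀ ℕ) (a : ι) (n : ℕ) :
    (μ + Finsupp.single a n).prod (fun i m => x i ^ m) = x a ^ n * μ.prod fun i m => x i ^ m := by
  classical
  rw [Finsupp.prod_add_index' (by simp) (by intros; exact pow_add _ _ _),
    Finsupp.prod_single_index (by simp), mul_comm]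

/-- Expanding each factor as a geometric series, one index at a time, gives the sum over occupation
numbers. -/
lemma hasSum_support_subset {x : ι → ℝ} (hx : ∀ i, |x i| < 1) (s : Finset ι) :
    HasSum (fun μ : {μ : ι →₀ ℕ // μ.support ⊆ s} => μ.1.prod fun i n => x i ^ n)
      (∏ i ∈ s, (1 - x i)⁻¹) := by
  classical
  induction s using Finset.induction_on with
  | empty =>
    have h0 (μ : {μ : ι →₀ ℕ // μ.support ⊆ ∅}) : μ = ⟨0, by simp⟩ :=
      Subtype.ext (by simpa using μ.2)
    have h := hasSum_single (f := fun μ : {μ : ι →₀ ℕ // μ.support ⊆ ∅} =>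
      μ.1.prod fun i n => x i ^ n) ⟨0, by simp⟩ fun μ hμ => absurd (h0 μ) hμ
    simpa using h
  | insert a s ha ih =>
    have hsum := hasSum_mul_prod (hasSum_geometric_of_abs_lt_one (hx a)) ih
    rw [Finset.prod_insert ha, ← (insertSupportEquiv ha).hasSum_iff]
    refine hsum.congr_fun fun y => ?_
    exact prod_pow_add_single x y.2.1 a y.1

/-- From `(1 - x)⁻¹ = 1 + x/(1 - x) ≤ 1 + x/(1 - q) ≤ exp (x/(1 - q))`. The bound is uniform in `s`,
which yields summability over all occupation numbers. -/
lemma prod_inv_one_sub_le {x : ι → ℝ} {q : ℝ} (hq : q < 1) (hx0 : ∀ i, 0 ≤ x i)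
    (hx : ∀ i, x i ≤ q) (hs : Summable x) (s : Finset ι) :
    ∏ i ∈ s, (1 - x i)⁻¹ ≤ Real.exp ((∑' i, x i) / (1 - q)) := by
  have h1 (i) : (1 - x i)⁻¹ ≤ Real.exp (x i / (1 - q)) := by
    have h2 : 0 < 1 - x i := by linarith [hx i]
    refine le_trans ?_ (Real.add_one_le_exp _)
    have h3 : (1 - x i)⁻¹ = x i / (1 - x i) + 1 := by field_simp; ring
    rw [h3]
    have := hx0 i
    gcongr
    exact hx i
  calc ∏ i ∈ s, (1 - x i)⁻¹ ≤ ∏ i ∈ s, Real.exp (x i / (1 - q)) :=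
        Finset.prod_le_prod (fun i _ => inv_nonneg.2 (by linarith [hx i])) fun i _ => h1 i
    _ = Real.exp ((∑ i ∈ s, x i) / (1 - q)) := by rw [← Real.exp_sum, Finset.sum_div]
    _ ≤ _ := by
        have := hs.sum_le_tsum s fun i _ => hx0 i
        have : 0 < 1 - q := by linarith
        gcongr

lemma summable_prod_pow {x : ι → ℝ} {q : ℝ} (hq : q < 1) (hx0 : ∀ i, 0 ≤ x i)
    (hx : ∀ i, x i ≤ q) (hs : Summable x) :
    Summable fun μ : ι →₀ ℕ => μ.prod fun i n => x i ^ n := by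
  classical
  have h0 (μ : ι →₀ ℕ) : 0 ≤ μ.prod fun i n => x i ^ n :=
    Finset.prod_nonneg fun i _ => pow_nonneg (hx0 i) _
  refine summable_of_sum_le h0 (c := Real.exp ((∑' i, x i) / (1 - q))) fun u => ?_
  refine le_trans ?_ (prod_inv_one_sub_le hq hx0 hx hs (u.biUnion Finsupp.support))
  have h := (hasSum_support_subset (x := x)
    (fun i => by rw [abs_of_nonneg (hx0 i)]; exact (hx i).trans_lt hq)
    (u.biUnion Finsupp.support))
  have h' := (hasSum_subtype_iff_indicator (s := {μ : ι →₀ ℕ | μ.support ⊆ u.biUnion _})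
    (f := fun μ : ι →₀ ℕ => μ.prod fun i n => x i ^ n)).1 h
  refine le_trans (le_of_eq ?_) (sum_le_hasSum u (fun μ _ => ?_) h')
  · refine Finset.sum_congr rfl fun μ hμ => ?_
    rw [Set.indicator_of_mem]
    exact Finset.subset_biUnion_of_mem Finsupp.support hμ
  · exact Set.indicator_nonneg (fun μ _ => h0 μ) _

theorem hasProd_inv_one_sub {x : ι → ℝ} {q : ℝ} (hq : q < 1) (hx : ∀ i, |x i| ≤ q)
    (hs : Summable fun i => |x i|) :
    HasProd (fun i => (1 - x i)⁻¹) (∑' μ : ι →₀ ℕ, μ.prod fun i n => x i ^ n) := by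
  classical
  have hb := summable_prod_pow hq (fun i => abs_nonneg (x i)) hx hs
  have hind (s : Finset ι) := ((hasSum_subtype_iff_indicator
    (s := {μ : ι →₀ ℕ | μ.support ⊆ s}) (f := fun μ : ι →₀ ℕ => μ.prod fun i n => x i ^ n)).1
    (hasSum_support_subset (fun i => (hx i).trans_lt hq) s)).tsum_eq
  rw [HasProd, SummationFilter.unconditional_filter]
  simp only [← hind]
  -- Finite products are sums restricted to supports inside `s`; they are dominated by the series
  -- for `|x i|`, and each `μ` is eventually included.
  refine tendsto_tsum_of_dominated_convergence hb (fun μ => ?_) (.of_forall fun s μ => ?_)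
  · refine tendsto_const_nhds.congr' ?_
    filter_upwards [eventually_ge_atTop μ.support] with s hs
    rw [Set.indicator_of_mem]
    exact hs
  · refine (norm_indicator_le_norm_self _ _).trans (le_of_eq ?_)
    rw [Finsupp.prod, Finsupp.prod, norm_prod]
    simp

end OccupationSum

/-! ### The theta function `∑ (-1)^n q^{n²}` as an infinite product -/

section Gauss

/-- The partial products `∏_{j=1}^n (1 - q^j) / (1 + q^j)`. -/
def gaussProd (q : ℝ) (n : ℕ) : ℝ := ∏ j ∈ Finset.range n, (1 - q ^ (j + 1)) / (1 + q ^ (j + 1))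

variable {q : ℝ}

lemma gaussProd_succ (q : ℝ) (n : ℕ) :
    gaussProd q (n + 1) = gaussProd q n * ((1 - q ^ (n + 1)) / (1 + q ^ (n + 1))) :=
  Finset.prod_range_succ _ _

lemma gaussProd_pos (h0 : 0 < q) (h1 : q < 1) (n : ℕ) : 0 < gaussProd q n := by
  refine Finset.prod_pos fun j _ => div_pos ?_ (by positivity)
  exact sub_pos.2 (pow_lt_one₀ h0.le h1 j.succ_ne_zero)

lemma gaussProd_antitone (h0 : 0 < q) (h1 : q < 1) : Antitone (gaussProd q) := by
  refine antitone_nat_of_succ_le fun n => ?_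
  rw [gaussProd_succ]
  refine mul_le_of_le_one_right (gaussProd_pos h0 h1 n).le ?_
  have : 0 < q ^ (n + 1) := by positivity
  rw [div_le_one (by positivity)]
  linarith

/-- The terms of the finite form of Gauss's identity. -/
def gaussTerm (q : ℝ) (n s : ℕ) : ℝ :=
  (-1) ^ s * (2 / (1 + q ^ s)) * (gaussProd q n / gaussProd q s) * (q ^ (n + 1)) ^ s

/-- The differences in `n` telescope in `s`; the right side is the closed form found by induction on
`m`. -/
lemma sum_gaussTerm_sub (h0 : 0 < q) (h1 : q < 1) (n m : ℕ) :
    ∑ s ∈ Finset.range (m + 1), (gaussTerm q (n + 1) s - gaussTerm q n s) =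
      -(2 * gaussProd q n / (1 + q ^ (n + 1))) *
        ((-1) ^ m * (q ^ (n + 1)) ^ (m + 1) / gaussProd q m) := by
  have hQ : 1 + q ^ (n + 1) ≠ 0 := by positivity
  induction m with
  | zero =>
    simp only [zero_add, Finset.sum_range_one, gaussTerm, gaussProd_succ q n, pow_zero]
    have : gaussProd q 0 = 1 := by simp [gaussProd]
    rw [this]
    field_simp
    ring
  | succ m ih =>
    rw [Finset.sum_range_succ, ih]
    simp only [gaussTerm, gaussProd_succ q n, gaussProd_succ q m]
    have hx : 1 - q ^ (m + 1) ≠ 0 :=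
      (sub_pos.2 (pow_lt_one₀ h0.le h1 m.succ_ne_zero)).ne'
    have hx' : 1 + q ^ (m + 1) ≠ 0 := by positivity
    have hP := (gaussProd_pos h0 h1 m).ne'
    have hpow : (q ^ (n + 1 + 1)) ^ (m + 1) = (q ^ (n + 1)) ^ (m + 1) * q ^ (m + 1) := by
      rw [← pow_mul, ← pow_mul, ← pow_add]
      congr 1
      ring
    rw [hpow]
    generalize q ^ (m + 1) = X at *
    generalize q ^ (n + 1) = Q at *
    rw [pow_succ Q (m + 1), pow_succ (-1 : ℝ) m]
    field_simp
    ring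

/-- At `m = n` the telescoped sum and the new term `s = n + 1` combine, the factor `1 + q^{n+1}`
cancelling, into `2 (-1)^{n+1} q^{(n+1)²}`. -/
theorem sum_gaussTerm (h0 : 0 < q) (h1 : q < 1) (n : ℕ) :
    ∑ s ∈ Finset.range (n + 1), gaussTerm q n s =
      2 * ∑ j ∈ Finset.range (n + 1), (-1) ^ j * q ^ (j ^ 2) - 1 := by
  induction n with
  | zero =>
    simp [gaussTerm, gaussProd]
    norm_num
  | succ n ih =>
    have h := sum_gaussTerm_sub h0 h1 n n
    rw [Finset.sum_sub_distrib, ih] at h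
    have hP := (gaussProd_pos h0 h1 n).ne'
    have hP' := (gaussProd_pos h0 h1 (n + 1)).ne'
    have hQ : 1 + q ^ (n + 1) ≠ 0 := by positivity
    rw [Finset.sum_range_succ _ (n + 1), Finset.sum_range_succ _ (n + 1),
      eq_add_of_sub_eq h, gaussTerm, div_self hP']
    have hpow : q ^ ((n + 1) ^ 2) = (q ^ (n + 1)) ^ (n + 1) := by rw [← pow_mul, sq]
    have hpow' : (q ^ (n + 1 + 1)) ^ (n + 1) = (q ^ (n + 1)) ^ (n + 1) * q ^ (n + 1) := by
      rw [← pow_mul, ← pow_mul, ← pow_add]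
      congr 1
      ring
    rw [hpow, hpow', pow_succ (-1 : ℝ) n]
    generalize q ^ (n + 1) = Q at *
    field_simp
    ring

/-- The term `s = 0` is the product itself, and each of the other `n` terms is at most `2 q^n` in
absolute value. -/
theorem tendsto_gaussProd_sub (h0 : 0 < q) (h1 : q < 1) :
    Tendsto (fun n => ∑ s ∈ Finset.range (n + 1), gaussTerm q n s - gaussProd q n) atTop
      (𝓝 0) := by
  have hlim : Tendsto (fun n : ℕ => 2 * ((n : ℝ) * q ^ n)) atTop (𝓝 0) := by
    simpa using (tendsto_self_mul_const_pow_of_lt_one h0.le h1).const_mul 2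
  refine squeeze_zero_norm (fun n => ?_) hlim
  have hterm0 : gaussTerm q n 0 = gaussProd q n := by
    simp [gaussTerm, gaussProd]
    norm_num
  rw [Finset.sum_range_succ', hterm0, add_sub_cancel_right]
  refine (norm_sum_le _ _).trans ?_
  have hb : ∀ s ∈ Finset.range n, ‖gaussTerm q n (s + 1)‖ ≤ 2 * q ^ n := by
    intro s hs
    have hP := gaussProd_pos h0 h1
    have h2 : 2 / (1 + q ^ (s + 1)) ≤ 2 := by
      rw [div_le_iff₀ (by positivity)]
      have : 0 < q ^ (s + 1) := by positivity
      linarith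
    have h3 : gaussProd q n / gaussProd q (s + 1) ≤ 1 := by
      rw [div_le_one (hP _)]
      exact gaussProd_antitone h0 h1 (Nat.succ_le_of_lt (Finset.mem_range.1 hs))
    have h4 : (q ^ (n + 1)) ^ (s + 1) ≤ q ^ n := by
      rw [← pow_mul]
      exact pow_le_pow_of_le_one h0.le h1.le (by nlinarith)
    have hn : ‖gaussTerm q n (s + 1)‖ = 2 / (1 + q ^ (s + 1)) *
        (gaussProd q n / gaussProd q (s + 1)) * (q ^ (n + 1)) ^ (s + 1) := by
      have := hP n
      have := hP (s + 1)
      rw [gaussTerm, norm_mul, norm_mul, norm_mul, norm_pow, norm_neg, norm_one, one_pow, one_mul,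
        Real.norm_of_nonneg (by positivity), Real.norm_of_nonneg (by positivity),
        Real.norm_of_nonneg (by positivity)]
    rw [hn]
    have hP1 := hP n
    have hP2 := hP (s + 1)
    calc _ ≤ 2 * 1 * q ^ n := by gcongr
      _ = 2 * q ^ n := by ring
  refine (Finset.sum_le_sum hb).trans (le_of_eq ?_)
  rw [Finset.sum_const, Finset.card_range, nsmul_eq_mul]
  ring

lemma summable_gauss (h0 : 0 < q) (h1 : q < 1) : Summable fun j : ℕ => (-1) ^ j * q ^ (j ^ 2) := by
  refine Summable.of_norm_bounded (summable_geometric_of_lt_one h0.le h1) fun j => ?_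
  rw [norm_mul, norm_pow, norm_neg, norm_one, one_pow, one_mul, Real.norm_of_nonneg (by positivity)]
  exact pow_le_pow_of_le_one h0.le h1.le (Nat.le_self_pow two_ne_zero j)

theorem tendsto_gaussProd (h0 : 0 < q) (h1 : q < 1) :
    Tendsto (gaussProd q) atTop (𝓝 (2 * ∑' j : ℕ, (-1) ^ j * q ^ (j ^ 2) - 1)) := by
  have h := ((summable_gauss h0 h1).hasSum.tendsto_sum_nat.comp (tendsto_add_atTop_nat 1))
  have h' := ((h.const_mul 2).sub_const 1).sub (tendsto_gaussProd_sub h0 h1)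
  rw [sub_zero] at h'
  refine h'.congr fun n => ?_
  rw [sum_gaussTerm h0 h1, Function.comp_apply]
  ring

end Gauss

/-! ### The vacuum character -/

section Character

variable {q : ℝ}

lemma weight_add_single (ν : ℕ+ →₀ ℕ) (r : ℕ+) :
    weight (ν + Finsupp.single r 1) = weight ν + r := by
  rw [weight, weight, Finsupp.sum_add_index' (by simp) (by intros; ring),
    Finsupp.sum_single_index (by simp), mul_one]

lemma prod_mul_pow_eq (a q : ℝ) (ν : ℕ+ →₀ ℕ) :
    (ν.prod fun r n => (a * q ^ (r : ℕ)) ^ n) = a ^ ν.degree * q ^ weight ν := by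
  induction ν using finsupp_induction_single with
  | h0 => simp [weight]
  | h1 ν r ih =>
    rw [prod_pow_add_single, ih, weight_add_single, map_add, Finsupp.degree_single, pow_add,
      pow_add]
    ring

lemma summable_pow_pnat (h0 : 0 < q) (h1 : q < 1) : Summable fun r : ℕ+ => q ^ (r : ℕ) :=
  (summable_geometric_of_lt_one h0.le h1).comp_injective PNat.coe_injective

lemma pow_pnat_le (h0 : 0 < q) (h1 : q < 1) (r : ℕ+) : q ^ (r : ℕ) ≤ q :=
  pow_le_of_le_one h0.le h1.le r.ne_zero

lemma summable_pow_weight (h0 : 0 < q) (h1 : q < 1) :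
    Summable fun ν : ℕ+ →₀ ℕ => q ^ weight ν := by
  have h := summable_prod_pow (x := fun r : ℕ+ => 1 * q ^ (r : ℕ)) h1 (fun r => by positivity)
    (fun r => by simpa using pow_pnat_le h0 h1 r) (by simpa using summable_pow_pnat h0 h1)
  exact h.congr fun ν => by rw [prod_mul_pow_eq, one_pow, one_mul]

/-- The sum of `ε ^ (number of oscillators) * q ^ energy` over the states of a chiral Fock
space. -/
def fockSum (ε q : ℝ) : ℝ := ∑' ν : ℕ+ →₀ ℕ, ε ^ ν.degree * q ^ weight ν

lemma hasSum_fockSum (h0 : 0 < q) (h1 : q < 1) {ε : ℝ} (hε : |ε| = 1) :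
    HasSum (fun ν : ℕ+ →₀ ℕ => ε ^ ν.degree * q ^ weight ν) (fockSum ε q) := by
  refine Summable.hasSum (Summable.of_norm_bounded (summable_pow_weight h0 h1) fun ν => ?_)
  rw [norm_mul, norm_pow, Real.norm_eq_abs, hε, one_pow, one_mul,
    Real.norm_of_nonneg (by positivity)]

lemma hasProd_fockSum (h0 : 0 < q) (h1 : q < 1) {ε : ℝ} (hε : |ε| = 1) :
    HasProd (fun n : ℕ => (1 - ε * q ^ (n + 1))⁻¹) (fockSum ε q) := by
  have ha (r : ℕ+) : |ε * q ^ (r : ℕ)| = q ^ (r : ℕ) := by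
    rw [abs_mul, hε, one_mul, abs_of_pos (by positivity)]
  have h := hasProd_inv_one_sub (x := fun r : ℕ+ => ε * q ^ (r : ℕ)) h1
    (fun r => (ha r).trans_le (pow_pnat_le h0 h1 r))
    (by simpa only [ha] using summable_pow_pnat h0 h1)
  simp only [prod_mul_pow_eq] at h
  exact (Equiv.pnatEquivNat.symm.hasProd_iff (f := fun r : ℕ+ => (1 - ε * q ^ (r : ℕ))⁻¹)).2 h

lemma fockSum_one_pos (h0 : 0 < q) (h1 : q < 1) : 0 < fockSum 1 q := by
  refine (hasSum_fockSum h0 h1 (by simp)).summable.tsum_pos (fun ν => by positivity) 0 ?_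
  simp [weight]

lemma tprod_one_sub_pow (h0 : 0 < q) (h1 : q < 1) :
    ∏' n : ℕ, (1 - q ^ (n + 1)) = (fockSum 1 q)⁻¹ := by
  have h := (hasProd_fockSum h0 h1 (ε := 1) (by simp)).inv₀ (fockSum_one_pos h0 h1).ne'
  simpa using h.tprod_eq

/-- The quotient of the two Fock sums is the limit of the products `∏ (1 - q^j)/(1 + q^j)` in
Gauss's identity. -/
theorem fockSum_neg_one (h0 : 0 < q) (h1 : q < 1) :
    fockSum (-1) q = fockSum 1 q * (2 * ∑' j : ℕ, (-1) ^ j * q ^ (j ^ 2) - 1) := by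
  have hp := (hasProd_fockSum h0 h1 (ε := 1) (by simp))
  have hm := (hasProd_fockSum h0 h1 (ε := -1) (by simp))
  have h := (hm.tendsto_prod_nat.div hp.tendsto_prod_nat (fockSum_one_pos h0 h1).ne')
  have h' := tendsto_nhds_unique (h.congr fun n => ?_) (tendsto_gaussProd h0 h1)
  · rw [← h', mul_div_cancel₀ _ (fockSum_one_pos h0 h1).ne']
  · rw [gaussProd, Pi.div_apply, ← Finset.prod_div_distrib]
    refine Finset.prod_congr rfl fun j _ => ?_
    rw [one_mul, neg_one_mul, sub_neg_eq_add, div_inv_eq_mul, div_eq_mul_inv, mul_comm]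

lemma tsum_gauss (h0 : 0 < q) (h1 : q < 1) :
    ∑' n : ℕ, (q ^ ((2 * n) ^ 2) - q ^ ((2 * n + 1) ^ 2)) =
      ∑' j : ℕ, (-1) ^ j * q ^ (j ^ 2) := by
  have hs := summable_gauss h0 h1
  have he : Summable fun n : ℕ => (-1) ^ (2 * n) * q ^ ((2 * n) ^ 2) :=
    hs.comp_injective (i := fun n : ℕ => 2 * n) fun a b (h : 2 * a = 2 * b) => by omega
  have ho : Summable fun n : ℕ => (-1) ^ (2 * n + 1) * q ^ ((2 * n + 1) ^ 2) :=
    hs.comp_injective (i := fun n : ℕ => 2 * n + 1)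
      fun a b (h : 2 * a + 1 = 2 * b + 1) => by omega
  rw [← tsum_even_add_odd (f := fun j : ℕ => (-1) ^ j * q ^ (j ^ 2)) he ho, ← he.tsum_add ho]
  refine tsum_congr fun n => ?_
  rw [pow_succ (-1 : ℝ), pow_mul (-1 : ℝ)]
  simp [sub_eq_add_neg]

/-- Averaging over `ε = ±1` projects to an even number of oscillators; the `-1` in `2 ∑ (-1)^j
q^{j²} - 1` cancels against the `ε = 1` term. -/
lemma hasSum_even (h0 : 0 < q) (h1 : q < 1) :
    HasSum (fun ν : ℕ+ →₀ ℕ => if Even ν.degree then q ^ weight ν else 0)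
      (fockSum 1 q * ∑' n : ℕ, (q ^ ((2 * n) ^ 2) - q ^ ((2 * n + 1) ^ 2))) := by
  have h := ((hasSum_fockSum h0 h1 (ε := 1) (by simp)).add
    (hasSum_fockSum h0 h1 (ε := -1) (by simp))).div_const 2
  have hc : fockSum 1 q * ∑' n : ℕ, (q ^ ((2 * n) ^ 2) - q ^ ((2 * n + 1) ^ 2)) =
      (fockSum 1 q + fockSum (-1) q) / 2 := by
    rw [tsum_gauss h0 h1, fockSum_neg_one h0 h1]
    ring
  rw [hc]
  refine h.congr_fun fun ν => ?_
  rcases Nat.even_or_odd ν.degree with hν | hν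
  · rw [if_pos hν, hν.neg_one_pow]
    simp
  · rw [if_neg (Nat.not_even_iff_odd.2 hν), hν.neg_one_pow]
    simp

lemma summable_pow_mul_sq {k : ℕ} (hk : 0 < k) (h0 : 0 < q) (h1 : q < 1) :
    Summable fun n : ℕ => q ^ (k * (n + 1) ^ 2) := by
  refine Summable.of_nonneg_of_le (fun n => by positivity) (fun n => ?_)
    (summable_geometric_of_lt_one h0.le h1)
  exact pow_le_pow_of_le_one h0.le h1.le (by nlinarith)

theorem hasSum_symLabel {k : ℕ} (hk : 0 < k) (h0 : 0 < q) (h1 : q < 1) :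
    HasSum (fun x : SymLabel => q ^ (k * x.1.1 ^ 2 + weight x.1.2))
      ((∑' n : ℕ, q ^ (k * (n + 1) ^ 2)) * fockSum 1 q +
        fockSum 1 q * ∑' n : ℕ, (q ^ ((2 * n) ^ 2) - q ^ ((2 * n + 1) ^ 2))) := by
  classical
  have ha : HasSum (fun s : ℕ => if s = 0 then 0 else q ^ (k * s ^ 2))
      (∑' n : ℕ, q ^ (k * (n + 1) ^ 2)) := by
    have h := HasSum.zero_add (f := fun s : ℕ => if s = 0 then 0 else q ^ (k * s ^ 2))
      (by simpa using (summable_pow_mul_sq hk h0 h1).hasSum)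
    simpa using h
  -- The positive charges carry all oscillator states, and charge zero only those with an even
  -- number of oscillators.
  have hA := hasSum_mul_prod ha (hasSum_fockSum h0 h1 (ε := 1) (by simp))
  have hB := hasSum_mul_prod (hasSum_ite_eq (0 : ℕ) (1 : ℝ)) (hasSum_even h0 h1)
  have h := hA.add hB
  rw [one_mul] at h
  refine (hasSum_subtype_iff_indicator (s := {x : ℕ × (ℕ+ →₀ ℕ) | x.1 = 0 → Even x.2.degree})
    (f := fun x => q ^ (k * x.1 ^ 2 + weight x.2))).2 ?_
  convert h using 1
  ext ⟨s, ν⟩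
  rcases eq_or_ne s 0 with rfl | hs
  · by_cases hν : Even ν.degree
    · rw [Set.indicator_of_mem (by simpa using hν)]
      simp [hν]
    · rw [Set.indicator_of_notMem (by simpa using hν)]
      simp [hν]
  · rw [Set.indicator_of_mem (by simp [hs])]
    simp [hs, pow_add]

theorem hasSum_chiralEnergy {k : ℕ} (hk : 0 < k) (h0 : 0 < q) (h1 : q < 1) :
    HasSum (fun x : SymLabel => q ^ chiralEnergy k x) (vacuumCharacter k q) := by
  have h := (hasSum_symLabel hk h0 h1).div_const (q ^ (1 / 24 : ℝ))
  have hc : vacuumCharacter k q = ((∑' n : ℕ, q ^ (k * (n + 1) ^ 2)) * fockSum 1 q +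
      fockSum 1 q * ∑' n : ℕ, (q ^ ((2 * n) ^ 2) - q ^ ((2 * n + 1) ^ 2))) /
        q ^ (1 / 24 : ℝ) := by
    rw [vacuumCharacter, tsum_div_const, tsum_div_const, eta, tprod_one_sub_pow h0 h1]
    have := (fockSum_one_pos h0 h1).ne'
    have := (Real.rpow_pos_of_pos h0 (1 / 24)).ne'
    field_simp
  rw [hc]
  refine h.congr_fun fun x => ?_
  rw [chiralEnergy, Real.rpow_sub h0, Real.rpow_natCast]

end Character

end OrbifoldBoson

end

theorem proposition1 (k : ℕ) (hk : 0 < k) :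
    (∀ A ∈ OrbifoldBoson.modeSet k, Commute A OrbifoldBoson.reflection) ∧
    OrbifoldBoson.generatedFrom k (OrbifoldBoson.ket 0 0) = OrbifoldBoson.vacuumModule k ∧
    ∀ q : ℝ, 0 < q → q < 1 →
      OrbifoldBoson.HasPowTrace (OrbifoldBoson.hamiltonian k) (OrbifoldBoson.vacuumModule k) q
        (OrbifoldBoson.vacuumCharacter k q ^ 2) :=
  ⟨fun _ hA => OrbifoldBoson.commute_reflection hA,
    (OrbifoldBoson.generatedFrom_eq hk).trans (OrbifoldBoson.vacuumModule_eq_symFock k).symm,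
    fun _ h0 h1 => OrbifoldBoson.hasPowTrace_vacuumModule hk h0
      (OrbifoldBoson.hasSum_chiralEnergy hk h0 h1)⟩
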